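/- Let $k\ge 1$ and let $\Lambda=(\Lambda^0,\Lambda,r,s,d)$ be a $k$-graph, i.e. a countable small category with a degree functor $d:\Lambda\to\mathbb N^k$ such that every $\lambda\in\Lambda$ with $d(\lambda)=m+n$ factors uniquely as $\lambda=\mu\nu$ with $d(\mu)=m$, $d(\nu)=n$ (the product $\mu\nu$ being defined when $s(\mu)=r(\nu)$). Write $v\Lambda^n=\{\lambda: r(\lambda)=v,\ d(\lambda)=n\}$. Assume that $\Lambda^0\neq\emptyset$ and that $\Lambda$ is row-finite without sources: every $v\Lambda^n$ ($v\in\Lambda^0$, $n\in\mathbb N^k$) is finite and non-empty. Let $R$ be a commutative ring with $1\neq 0$. Let $\Omega_k$ be the $k$-graph with vertex set $\mathbb N^k$ and one path $(m,n)$, of range $m$, source $n$ and degree $n-m$, for each pair $m\le n$; an infinite path in $\Lambda$ is a degree preserving functor $x:\Omega_k\to\Lambda$, and $x(n)$ denotes the image of the vertex $n$. Let $T_\Lambda$ be the commutative monoid generated by symbols $v(n)$, $v\in\Lambda^0$, $n\in\mathbb Z^k$, subject to $v(n)=\sum_{\alpha\in v\Lambda^{e_i}}s(\alpha)(n+e_i)$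 for all $v$, $n$ and $1\le i\le k$, with $\mathbb Z^k$ acting by ${}^m v(n)=v(n+m)$. A $\mathbb Z^k$-order ideal of a $\mathbb{Z}^k$-monoid is a $\mathbb Z^k$-invariant submonoid $J$ such that $x+z\in J$ implies $x\in J$; a $\mathbb Z^k$-monoid $M$ is simple if it is non-zero, conical ($x+z=0$ implies $x=0$) and its only $\mathbb Z^k$-order ideals are $\{0\}$ and $M$. Let $\mathrm{KP}_R(\Lambda)$ be the Kumjian-Pask algebra: the universal (not necessarily unital) $R$-algebra generated by elements $p_v$ ($v\in\Lambda^0$), $s_\lambda$, $s_{\lambda^*}$ ($\lambda\in\Lambda$; $s_v=s_{v^*}=p_v$ for $v\in\Lambda^0$) such that $p_up_v=\delta_{u,v}p_u$; $s_\lambda s_\mu=s_{\lambda\mu}$ and $s_{\mu^*}s_{\lambda^*}=s_{(\lambda\mu)^*}$ if $s(\lambda)=r(\mu)$; $p_{r(\lambda)}s_\lambda=s_\lambda=s_\lambda p_{s(\lambda)}$ and $p_{s(\lambda)}s_{\lambda^*}=s_{\lambda^*}=s_{\lambda^*}p_{r(\lambda)}$; $s_{\lambda^*}s_\mu=\delta_{\lambda,\mu}p_{s(\lambda)}$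 if $d(\lambda)=d(\mu)$; and $p_v=\sum_{\lambda\in v\Lambda^n}s_\lambda s_{\lambda^*}$ for all $v\in\Lambda^0$, $n\in\mathbb N^k$. It is $\mathbb Z^k$-graded with $n$-th component the $R$-span of all $s_\lambda s_{\mu^*}$ with $s(\lambda)=s(\mu)$ and $d(\lambda)-d(\mu)=n$. A two-sided ideal $I$ is graded if each of its elements is a sum of homogeneous elements of $I$, and basic if $cp_v\in I$ with $v\in\Lambda^0$ and $0\neq c\in R$ implies $p_v\in I$. Then the following are equivalent. (i) $\Lambda$ is cofinal: for every infinite path $x$ and every $v\in\Lambda^0$ there are $n\in\mathbb N^k$ and $\lambda\in\Lambda$ with $r(\lambda)=v$ and $s(\lambda)=x(n)$. (ii) $T_\Lambda$ is a simple $\mathbb Z^k$-monoid. (iii) $\emptyset$ and $\Lambda^0$ are the only subsets $H\subseteq\Lambda^0$ that are hereditary ($r(\lambda)\in H$ implies $s(\lambda)\in H$) and saturated ($s(v\Lambda^n)\subseteq H$ for some $n\in\mathbb N^k$ implies $v\in H$). (iv) $\mathrm{KP}_R(\Lambda)$ is graded basic ideal simple: its only graded basic ideals are $\{0\}$ and $\mathrm{KP}_R(\Lambda)$.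 (v) The only basic ideal of $\mathrm{KP}_R(\Lambda)$ that contains $p_v$ for some $v\in\Lambda^0$ is $\mathrm{KP}_R(\Lambda)$ itself. -/

import Mathlib

universe u v w

/-- A `k`-graph: a countable small category with object set `Vertex` and set of morphisms `Path`,
written as a partial composition on `Path` (`λμ` is defined iff `s λ = r μ`), with a degree functor
`d` to `ℕᵏ` that has the unique factorization property. -/
structure KGraph (k : ℕ) where
  Vertex : Type u
  Path : Type u
  countable_path : Countable Path
  r : Path → Vertex
  s : Path → Vertex
  /-- the identity morphism at a vertex -/
  idPath : Vertex → Path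
  comp : (p q : Path) → s p = r q → Path
  r_idPath : ∀ x, r (idPath x) = x
  s_idPath : ∀ x, s (idPath x) = x
  r_comp : ∀ p q h, r (comp p q h) = r p
  s_comp : ∀ p q h, s (comp p q h) = s q
  id_comp : ∀ p, comp (idPath (r p)) p (s_idPath (r p)) = p
  comp_id : ∀ p, comp p (idPath (s p)) (r_idPath (s p)).symm = p
  assoc : ∀ (p q t : Path) (h : s p = r q) (h' : s q = r t),
    comp (comp p q h) t ((s_comp p q h).trans h') = comp p (comp q t h') (h.trans (r_comp q t h').symm)
  d : Path → Fin k → ℕ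
  d_idPath : ∀ x, d (idPath x) = 0
  d_comp : ∀ p q h, d (comp p q h) = d p + d q
  factorization : ∀ (p : Path) (m n : Fin k → ℕ), d p = m + n →
    ∃! q : Path × Path, d q.1 = m ∧ d q.2 = n ∧ ∃ h : s q.1 = r q.2, comp q.1 q.2 h = p

/-- A `k`-graph morphism: a degree preserving functor. -/
structure KGraph.Hom {k : ℕ} (Ω : KGraph.{u} k) (Λ : KGraph.{v} k) where
  onVertex : Ω.Vertex → Λ.Vertex
  onPath : Ω.Path → Λ.Path
  map_r : ∀ p, Λ.r (onPath p) = onVertex (Ω.r p)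
  map_s : ∀ p, Λ.s (onPath p) = onVertex (Ω.s p)
  map_id : ∀ x, onPath (Ω.idPath x) = Λ.idPath (onVertex x)
  map_comp : ∀ p q h, onPath (Ω.comp p q h) =
    Λ.comp (onPath p) (onPath q) (((map_s p).trans (congrArg onVertex h)).trans (map_r q).symm)
  map_d : ∀ p, Λ.d (onPath p) = Ω.d p

/-- The infinite grid graph `Ω_k`: vertices `ℕᵏ`, paths the pairs `(m, n)` with `m ≤ n`,
`r (m, n) = m`, `s (m, n) = n`, `(m, n)(n, p) = (m, p)` and `d (m, n) = n - m`. -/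
def gridGraph (k : ℕ) : KGraph.{0} k where
  Vertex := Fin k → ℕ
  Path := {p : (Fin k → ℕ) × (Fin k → ℕ) // p.1 ≤ p.2}
  countable_path := inferInstance
  r p := p.1.1
  s p := p.1.2
  idPath m := ⟨(m, m), le_refl m⟩
  comp p q h := ⟨(p.1.1, q.1.2), p.2.trans (h.le.trans q.2)⟩
  r_idPath _ := rfl
  s_idPath _ := rfl
  r_comp _ _ _ := rfl
  s_comp _ _ _ := rfl
  id_comp _ := rfl
  comp_id _ := rfl
  assoc _ _ _ _ _ := rfl
  d p := p.1.2 - p.1.1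
  d_idPath m := by simp
  d_comp := by
    rintro ⟨⟨a, b⟩, h₁⟩ ⟨⟨b', c⟩, h₂⟩ h
    obtain rfl : b = b' := h
    funext i
    have := h₁ i
    have := h₂ i
    simp only [Pi.add_apply, Pi.sub_apply] at *
    omega
  factorization := by
    rintro ⟨⟨a, c⟩, hac⟩ m n hd
    have hd' : ∀ i, c i - a i = m i + n i := fun i => congrFun hd i
    have hac' : ∀ i, a i ≤ c i := hac
    refine ⟨(⟨(a, a + m), fun i => Nat.le_add_right _ _⟩,
      ⟨(a + m, c), fun i => ?_⟩), ⟨?_, ?_, rfl, rfl⟩, ?_⟩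
    · have := hd' i
      have := hac' i
      simp only [Pi.add_apply]
      omega
    · funext i
      simp
    · funext i
      have := hd' i
      simp only [Pi.add_apply, Pi.sub_apply]
      omega
    · rintro ⟨⟨⟨a', b⟩, h₁⟩, ⟨⟨b', c'⟩, h₂⟩⟩ ⟨hm, hn, hb, hp⟩
      obtain rfl : b = b' := hb
      obtain ⟨rfl, rfl⟩ : a' = a ∧ c' = c := by
        simpa [Subtype.ext_iff, Prod.ext_iff] using hp
      have hb : b = a' + m := by
        funext i
        have h₃ : b i - a' i = m i := congrFun hm i
        have h₄ : a' i ≤ b i := h₁ i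
        simp only [Pi.add_apply]
        omega
      subst hb
      rfl

namespace KGraph

variable {k : ℕ} (Λ : KGraph.{u} k)

/-- `vΛⁿ`, the set of paths of degree `n` with range `v`. -/
def pathsFrom (x : Λ.Vertex) (n : Fin k → ℕ) : Set Λ.Path := {p | Λ.r p = x ∧ Λ.d p = n}

/-- Row-finiteness: every `vΛⁿ` is finite. -/
class RowFinite : Prop where
  finite : ∀ x n, (Λ.pathsFrom x n).Finite

/-- `Λ` has no sources: every `vΛⁿ` is non-empty. -/
def NoSources : Prop := ∀ x n, (Λ.pathsFrom x n).Nonempty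

/-- `Λ^∞`: the `k`-graph morphisms from the infinite grid graph. -/
abbrev InfinitePath := Hom (gridGraph k) Λ

/-- Cofinality: for all `x ∈ Λ^∞` and `v ∈ Λ⁰` there is `n` with `vΛx(n) ≠ ∅`. -/
def Cofinal : Prop :=
  ∀ (x : Λ.InfinitePath) (a : Λ.Vertex), ∃ n : Fin k → ℕ, ∃ p : Λ.Path,
    Λ.r p = a ∧ Λ.s p = x.onVertex n

def IsHereditary (H : Set Λ.Vertex) : Prop := ∀ p : Λ.Path, Λ.r p ∈ H → Λ.s p ∈ H

def IsSaturated (H : Set Λ.Vertex) : Prop :=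
  ∀ (x : Λ.Vertex) (n : Fin k → ℕ), Λ.s '' Λ.pathsFrom x n ⊆ H → x ∈ H

end KGraph

/-- `M` is conical: `0` is the only unit, i.e. the only element below `0` in the algebraic
pre-order. -/
def IsConicalMonoid (M : Type*) [AddCommMonoid M] : Prop := ∀ x z : M, 0 = x + z → x = 0

/-- A `Γ`-order ideal of a `Γ`-monoid: a submonoid that is a down-set for the algebraic pre-order
and is closed under the action. -/
structure IsGammaOrderIdeal (Γ : Type*) {M : Type*} [Group Γ] [AddCommMonoid M]
    [DistribMulAction Γ M] (J : AddSubmonoid M) : Prop where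
  down : ∀ x y : M, (∃ z, y = x + z) → y ∈ J → x ∈ J
  smul_mem : ∀ (g : Γ) (x : M), x ∈ J → g • x ∈ J

/-- A simple `Γ`-monoid: non-zero, conical, and with only the two trivial `Γ`-order ideals. -/
structure IsSimpleGammaMonoid (Γ M : Type*) [Group Γ] [AddCommMonoid M]
    [DistribMulAction Γ M] : Prop where
  nontrivial : Nontrivial M
  conical : IsConicalMonoid M
  eq_bot_or_eq_top : ∀ J : AddSubmonoid M, IsGammaOrderIdeal Γ J → J = ⊥ ∨ J = ⊤

noncomputable section

namespace KGraph

variable {k : ℕ} (Λ : KGraph.{u} k) [Λ.RowFinite]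

/-- `vΛⁿ` as a finite set. -/
def pathsFinset (x : Λ.Vertex) (n : Fin k → ℕ) : Finset Λ.Path :=
  (RowFinite.finite (Λ := Λ) x n).toFinset

/-- The free commutative monoid on the symbols `v(n)`, `v ∈ Λ⁰`, `n ∈ ℤᵏ`. -/
abbrev FreeTalented := (Λ.Vertex × (Fin k → ℤ)) →₀ ℕ

/-- The defining relations `v(n) = ∑_{α ∈ vΛ^{e_i}} s(α)(n + e_i)`, whenever `vΛ^{e_i} ≠ ∅`. -/
inductive TalentedRel : Λ.FreeTalented → Λ.FreeTalented → Prop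
  | rel (x : Λ.Vertex) (n : Fin k → ℤ) (i : Fin k)
      (h : (Λ.pathsFrom x (Pi.single i 1)).Nonempty) :
      TalentedRel (Finsupp.single (x, n) 1)
        (∑ p ∈ Λ.pathsFinset x (Pi.single i 1), Finsupp.single (Λ.s p, n + Pi.single i 1) 1)

/-- The congruence generated by the defining relations. -/
def talentedCon : AddCon Λ.FreeTalented := addConGen Λ.TalentedRel

/-- The talented monoid `T_Λ`. -/
def TalentedMonoid : Type u := Λ.talentedCon.Quotient

instance : AddCommMonoid Λ.TalentedMonoid :=
  inferInstanceAs (AddCommMonoid Λ.talentedCon.Quotient)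

/-- The state shift `v(m) ↦ v(m + n)` on the free commutative monoid. -/
def freeShift (n : Fin k → ℤ) : Λ.FreeTalented →+ Λ.FreeTalented :=
  Finsupp.mapDomain.addMonoidHom (fun a => (a.1, a.2 + n))

/-- The state shift on the free commutative monoid preserves the congruence. -/
theorem freeShift_rel (n : Fin k → ℤ) {a b : Λ.FreeTalented} (h : Λ.talentedCon a b) :
    Λ.talentedCon (Λ.freeShift n a) (Λ.freeShift n b) := by
  have key : Λ.talentedCon ≤ Λ.talentedCon.comap (Λ.freeShift n) (map_add _) := by
    refine AddCon.addConGen_le.2 ?_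
    rintro _ _ ⟨x, m, i, hx⟩
    refine AddConGen.Rel.of _ _ ?_
    have := TalentedRel.rel (Λ := Λ) x (m + n) i hx
    simpa [freeShift, Finsupp.mapDomain_single, map_sum, add_right_comm] using this
  exact key h

/-- The state shift `v(m) ↦ v(m + n)` on `T_Λ`. -/
def shift (n : Fin k → ℤ) : Λ.TalentedMonoid →+ Λ.TalentedMonoid :=
  Λ.talentedCon.lift ((Λ.talentedCon.mk').comp (Λ.freeShift n))
    (fun _ _ h => (AddCon.eq _).2 (Λ.freeShift_rel n h))

/-- The `ℤᵏ`-monoid structure of `T_Λ`, given on generators by `ⁿv(m) = v(m + n)`. -/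
instance : DistribMulAction (Multiplicative (Fin k → ℤ)) Λ.TalentedMonoid where
  smul g x := Λ.shift g.toAdd x
  one_smul x := by
    induction x using AddCon.induction_on with
    | H x =>
      refine congrArg (Λ.talentedCon.mk') ?_
      change Finsupp.mapDomain _ x = x
      convert Finsupp.mapDomain_id using 2
      funext a
      simp
  mul_smul g h x := by
    induction x using AddCon.induction_on with
    | H x =>
      refine congrArg (Λ.talentedCon.mk') ?_
      change Finsupp.mapDomain _ x = Finsupp.mapDomain _ (Finsupp.mapDomain _ x)
      rw [← Finsupp.mapDomain_comp]
      congr 1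
      funext a
      simp [add_assoc, add_comm (Multiplicative.toAdd g)]
  smul_zero g := map_zero (Λ.shift g.toAdd)
  smul_add g := map_add (Λ.shift g.toAdd)

/-- Generators of the Kumjian-Pask algebra: `p_v`, `s_λ` and `s_{λ*}`. -/
inductive KPGen : Type u
  | vertex : Λ.Vertex → KPGen
  | path : Λ.Path → KPGen
  | ghost : Λ.Path → KPGen

variable (R : Type w) [CommRing R]

/-- The free (associative, non-unital) `R`-algebra on the generators, with basis the non-empty
words. -/
abbrev FreeKP := MonoidAlgebra R (FreeSemigroup Λ.KPGen)

/-- A generator as an element of the free algebra. -/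
def freeGen (g : Λ.KPGen) : Λ.FreeKP R := MonoidAlgebra.single (FreeSemigroup.of g) 1

/-- The Kumjian-Pask relations. The symbols `s_λ`, `s_{λ*}` are used for all `λ ∈ Λ`; at the
vertices they are identified with `p_v`, and then the relations for paths of non-zero degree are
equivalent to the same relations for all paths. -/
inductive KPRel : Λ.FreeKP R → Λ.FreeKP R → Prop
  | path_id (x) : KPRel (Λ.freeGen R (.path (Λ.idPath x))) (Λ.freeGen R (.vertex x))
  | ghost_id (x) : KPRel (Λ.freeGen R (.ghost (Λ.idPath x))) (Λ.freeGen R (.vertex x))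
  | kp1_self (x) :
      KPRel (Λ.freeGen R (.vertex x) * Λ.freeGen R (.vertex x)) (Λ.freeGen R (.vertex x))
  | kp1_ne (x y) (h : x ≠ y) : KPRel (Λ.freeGen R (.vertex x) * Λ.freeGen R (.vertex y)) 0
  | kp2_path (p q) (h : Λ.s p = Λ.r q) :
      KPRel (Λ.freeGen R (.path p) * Λ.freeGen R (.path q)) (Λ.freeGen R (.path (Λ.comp p q h)))
  | kp2_ghost (p q) (h : Λ.s p = Λ.r q) :
      KPRel (Λ.freeGen R (.ghost q) * Λ.freeGen R (.ghost p))
        (Λ.freeGen R (.ghost (Λ.comp p q h)))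
  | kp2_range_path (p) :
      KPRel (Λ.freeGen R (.vertex (Λ.r p)) * Λ.freeGen R (.path p)) (Λ.freeGen R (.path p))
  | kp2_path_source (p) :
      KPRel (Λ.freeGen R (.path p) * Λ.freeGen R (.vertex (Λ.s p))) (Λ.freeGen R (.path p))
  | kp2_source_ghost (p) :
      KPRel (Λ.freeGen R (.vertex (Λ.s p)) * Λ.freeGen R (.ghost p)) (Λ.freeGen R (.ghost p))
  | kp2_ghost_range (p) :
      KPRel (Λ.freeGen R (.ghost p) * Λ.freeGen R (.vertex (Λ.r p))) (Λ.freeGen R (.ghost p))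
  | kp3_self (p) :
      KPRel (Λ.freeGen R (.ghost p) * Λ.freeGen R (.path p)) (Λ.freeGen R (.vertex (Λ.s p)))
  | kp3_ne (p q) (hd : Λ.d p = Λ.d q) (h : p ≠ q) :
      KPRel (Λ.freeGen R (.ghost p) * Λ.freeGen R (.path q)) 0
  | kp4 (x n) :
      KPRel (Λ.freeGen R (.vertex x))
        (∑ p ∈ Λ.pathsFinset x n, Λ.freeGen R (.path p) * Λ.freeGen R (.ghost p))

/-- Scalar multiples of the Kumjian-Pask relations. -/
inductive KPScaledRel : Λ.FreeKP R → Λ.FreeKP R → Prop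
  | smul (c : R) {a b : Λ.FreeKP R} (h : Λ.KPRel R a b) : KPScaledRel (c • a) (c • b)

/-- The algebra congruence generated by the Kumjian-Pask relations. -/
def kpCon : RingCon (Λ.FreeKP R) := ringConGen (Λ.KPScaledRel R)

theorem kpCon_smul (c : R) {a b : Λ.FreeKP R} (h : Λ.kpCon R a b) :
    Λ.kpCon R (c • a) (c • b) := by
  change RingConGen.Rel (Λ.KPScaledRel R) a b at h
  induction h with
  | of _ _ h =>
    obtain ⟨e, h⟩ := h
    simp only [smul_smul]
    exact RingConGen.Rel.of _ _ (.smul _ h)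
  | refl _ => exact (Λ.kpCon R).refl _
  | symm _ ih => exact (Λ.kpCon R).symm ih
  | trans _ _ ih₁ ih₂ => exact (Λ.kpCon R).trans ih₁ ih₂
  | add _ _ ih₁ ih₂ =>
    simp only [smul_add]
    exact (Λ.kpCon R).add ih₁ ih₂
  | mul _ h₂ ih₁ _ =>
    simp only [← smul_mul_assoc]
    exact (Λ.kpCon R).mul ih₁ h₂

/-- The Kumjian-Pask algebra `KP_R(Λ)`: the (non-unital) `R`-algebra given by the generators and
the Kumjian-Pask relations. -/
def KPAlgebra : Type (max u w) := (Λ.kpCon R).Quotient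

namespace KPAlgebra

instance : NonUnitalRing (Λ.KPAlgebra R) := inferInstanceAs (NonUnitalRing (Λ.kpCon R).Quotient)

/-- The quotient map from the free algebra. -/
def mk (a : Λ.FreeKP R) : Λ.KPAlgebra R := (a : (Λ.kpCon R).Quotient)

instance : SMul R (Λ.KPAlgebra R) where
  smul c := Quotient.map' (c • ·) (fun _ _ h => Λ.kpCon_smul R c h)

instance : Module R (Λ.KPAlgebra R) where
  one_smul := by rintro ⟨a⟩; exact congrArg (mk Λ R) (one_smul R a)
  mul_smul c e := by rintro ⟨a⟩; exact congrArg (mk Λ R) (mul_smul c e a)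
  smul_zero c := congrArg (mk Λ R) (smul_zero c)
  smul_add c := by rintro ⟨a⟩ ⟨b⟩; exact congrArg (mk Λ R) (smul_add c a b)
  add_smul c e := by rintro ⟨a⟩; exact congrArg (mk Λ R) (add_smul c e a)
  zero_smul := by rintro ⟨a⟩; exact congrArg (mk Λ R) (zero_smul R a)

instance : IsScalarTower R (Λ.KPAlgebra R) (Λ.KPAlgebra R) where
  smul_assoc c := by rintro ⟨a⟩ ⟨b⟩; exact congrArg (mk Λ R) (smul_mul_assoc c a b)

instance : SMulCommClass R (Λ.KPAlgebra R) (Λ.KPAlgebra R) where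
  smul_comm c := by rintro ⟨a⟩ ⟨b⟩; exact congrArg (mk Λ R) (mul_smul_comm c a b).symm

/-- The generator `p_v`. -/
def p (x : Λ.Vertex) : Λ.KPAlgebra R := mk Λ R (Λ.freeGen R (.vertex x))

/-- The element `s_λ`. -/
def s (q : Λ.Path) : Λ.KPAlgebra R := mk Λ R (Λ.freeGen R (.path q))

/-- The element `s_{λ*}`. -/
def sStar (q : Λ.Path) : Λ.KPAlgebra R := mk Λ R (Λ.freeGen R (.ghost q))

/-- The homogeneous component `KP_R(Λ)_n`: the span of all `s_λ s_{μ*}` with `s(λ) = s(μ)` and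
`d(λ) - d(μ) = n`. -/
def component (n : Fin k → ℤ) : Submodule R (Λ.KPAlgebra R) :=
  Submodule.span R {a | ∃ q t : Λ.Path, Λ.s q = Λ.s t ∧
    (fun i => (Λ.d q i : ℤ) - (Λ.d t i : ℤ)) = n ∧ a = s Λ R q * sStar Λ R t}

variable {Λ R}

/-- A graded ideal: every element is a sum of homogeneous elements of the ideal. -/
def IsGradedIdeal (I : TwoSidedIdeal (Λ.KPAlgebra R)) : Prop :=
  ∀ a ∈ I, a ∈ AddSubgroup.closure {b | b ∈ I ∧ ∃ n, b ∈ component Λ R n}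

/-- A basic ideal: `c p_v ∈ I` with `c ≠ 0` in `R` implies `p_v ∈ I`. -/
def IsBasicIdeal (I : TwoSidedIdeal (Λ.KPAlgebra R)) : Prop :=
  ∀ (x : Λ.Vertex) (c : R), c ≠ 0 → c • p Λ R x ∈ I → p Λ R x ∈ I

variable (Λ R)

/-- Graded basic ideal simplicity: the only graded basic ideals are `0` and the whole algebra. -/
def IsGradedBasicIdealSimple : Prop :=
  ∀ I : TwoSidedIdeal (Λ.KPAlgebra R), IsGradedIdeal I → IsBasicIdeal I → I = ⊥ ∨ I = ⊤

end KPAlgebra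

end KGraph

end

/-! Condition (iii) is the hub: hereditary saturated sets of vertices control infinite paths, order
ideals and ideals alike.

Cofinality. If `H` is hereditary and saturated and `a ∉ H`, saturation lets a path from `a` be
prolonged forever outside `H` (`exists_avoidingPath`). No vertex of `H` reaches such a path, so
cofinality forces `H` to be trivial. Conversely, the vertices that cannot reach a given infinite
path form a hereditary saturated set missing that path, hence the empty set.

Talented monoid. For `H` hereditary and saturated, being supported on `H` is invariant under the
defining congruence (`mem_supportedOn_congr`), so the symbols over `H` span an order ideal that
recovers `H`; the case `H = ∅` gives conicality and the non-vanishing of generators. Conversely, the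
vertices whose symbols lie in an order ideal form a hereditary saturated set determining that ideal.

Kumjian-Pask algebra. The vertices whose idempotents lie in an ideal form a hereditary saturated
set, which yields (v) from (iii). A non-zero homogeneous element is a combination of monomials `s_q
s_{t*}` with all `t` of one degree; compressing by `s_{q*}` and `s_t` isolates a coefficient times a
vertex idempotent. So a non-zero graded basic ideal contains some `p_v`, and (v) gives (iv). For
(iv) to (iii), the ideal generated by the `p_a`, `a ∈ H`, is graded. The algebra acts on functions
on the infinite paths avoiding `H`; this action kills the ideal, while `c p_a` acts non-trivially
for `a ∉ H` and `c ≠ 0`. Hence the ideal is basic and recovers `H`. -/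

namespace KGraph

/-! ### Initial segments and tails of paths -/

section Factorization

variable {k : ℕ} {Λ : KGraph.{u} k}

theorem comp_congr {p p' q q' : Λ.Path} (hp : p = p') (hq : q = q') (h : Λ.s p = Λ.r q) :
    Λ.comp p q h = Λ.comp p' q' (hp ▸ hq ▸ h) := by
  subst hp hq; rfl

theorem comp_injective {p p' q q' : Λ.Path} {h : Λ.s p = Λ.r q} {h' : Λ.s p' = Λ.r q'}
    (hd : Λ.d p = Λ.d p') (e : Λ.comp p q h = Λ.comp p' q' h') : p = p' ∧ q = q' := by
  have hq : Λ.d q = Λ.d q' := by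
    have := congrArg Λ.d e
    rwa [Λ.d_comp, Λ.d_comp, hd, add_right_inj] at this
  have := (Λ.factorization (Λ.comp p q h) (Λ.d p) (Λ.d q) (Λ.d_comp p q h)).unique
    (y₁ := (p, q)) (y₂ := (p', q')) ⟨rfl, rfl, h, rfl⟩ ⟨hd.symm, hq.symm, h', e.symm⟩
  exact Prod.ext_iff.1 this

/-- Cutting at the meet with `d p` makes `initSeg` and `tail` total, with no side condition on `n`.
-/
theorem exists_factorization (p : Λ.Path) (n : Fin k → ℕ) :
    ∃ q : Λ.Path × Λ.Path, Λ.d q.1 = Λ.d p ⊓ n ∧ Λ.d q.2 = Λ.d p - n ∧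
      ∃ h : Λ.s q.1 = Λ.r q.2, Λ.comp q.1 q.2 h = p := by
  refine (Λ.factorization p (Λ.d p ⊓ n) (Λ.d p - n) ?_).exists
  funext i
  simp only [Pi.add_apply, Pi.inf_apply, Pi.sub_apply]
  omega

/-- The initial segment of `p` of degree `d p ⊓ n`. -/
noncomputable def initSeg (p : Λ.Path) (n : Fin k → ℕ) : Λ.Path := (exists_factorization p n).choose.1

/-- What remains of `p` after removing its initial segment of degree `d p ⊓ n`. -/
noncomputable def tail (p : Λ.Path) (n : Fin k → ℕ) : Λ.Path := (exists_factorization p n).choose.2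

theorem d_init (p : Λ.Path) (n : Fin k → ℕ) : Λ.d (initSeg p n) = Λ.d p ⊓ n :=
  (exists_factorization p n).choose_spec.1

theorem d_init_of_le {p : Λ.Path} {n : Fin k → ℕ} (h : n ≤ Λ.d p) : Λ.d (initSeg p n) = n := by
  rw [d_init, inf_eq_right.2 h]

theorem d_tail (p : Λ.Path) (n : Fin k → ℕ) : Λ.d (tail p n) = Λ.d p - n :=
  (exists_factorization p n).choose_spec.2.1

theorem s_init (p : Λ.Path) (n : Fin k → ℕ) : Λ.s (initSeg p n) = Λ.r (tail p n) :=
  (exists_factorization p n).choose_spec.2.2.choose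

theorem init_comp_tail (p : Λ.Path) (n : Fin k → ℕ) :
    Λ.comp (initSeg p n) (tail p n) (s_init p n) = p :=
  (exists_factorization p n).choose_spec.2.2.choose_spec

theorem r_init (p : Λ.Path) (n : Fin k → ℕ) : Λ.r (initSeg p n) = Λ.r p := by
  conv_rhs => rw [← init_comp_tail p n, Λ.r_comp]

theorem s_tail (p : Λ.Path) (n : Fin k → ℕ) : Λ.s (tail p n) = Λ.s p := by
  conv_rhs => rw [← init_comp_tail p n, Λ.s_comp]

/-- Uniqueness of factorization in usable form: segments are computed by exhibiting any
factorization of the right degree. -/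
theorem init_tail_eq_of_comp_eq {p a b : Λ.Path} {n : Fin k → ℕ} {h : Λ.s a = Λ.r b}
    (hd : Λ.d a = Λ.d p ⊓ n) (e : Λ.comp a b h = p) : initSeg p n = a ∧ tail p n = b :=
  comp_injective (h := s_init p n) (h' := h) ((d_init p n).trans hd.symm)
    ((init_comp_tail p n).trans e.symm)

theorem init_tail_comp_of_le {a b : Λ.Path} (h : Λ.s a = Λ.r b) {n : Fin k → ℕ} (hn : n ≤ Λ.d a) :
    initSeg (Λ.comp a b h) n = initSeg a n ∧
      tail (Λ.comp a b h) n = Λ.comp (tail a n) b ((s_tail a n).trans h) := by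
  refine init_tail_eq_of_comp_eq
    (h := (s_init a n).trans (Λ.r_comp _ _ _).symm) ?_ ?_
  · rw [d_init, Λ.d_comp, inf_eq_right.2 hn, inf_eq_right.2 (hn.trans le_self_add)]
  · rw [← Λ.assoc _ _ _ (s_init a n)]
    exact comp_congr (init_comp_tail a n) rfl _

theorem init_tail_comp_add {a b : Λ.Path} (h : Λ.s a = Λ.r b) (n : Fin k → ℕ) :
    initSeg (Λ.comp a b h) (Λ.d a + n) = Λ.comp a (initSeg b n) (h.trans (r_init b n).symm) ∧
      tail (Λ.comp a b h) (Λ.d a + n) = tail b n := by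
  refine init_tail_eq_of_comp_eq (h := (Λ.s_comp _ _ _).trans (s_init b n)) ?_ ?_
  · rw [Λ.d_comp, Λ.d_comp, d_init]
    funext i
    simp
  · rw [Λ.assoc _ _ _ _ (s_init b n)]
    exact comp_congr rfl (init_comp_tail b n) _

theorem init_tail_self (p : Λ.Path) :
    initSeg p (Λ.d p) = p ∧ tail p (Λ.d p) = Λ.idPath (Λ.s p) :=
  init_tail_eq_of_comp_eq (by simp) (Λ.comp_id p)

theorem init_comp_left {a b : Λ.Path} (h : Λ.s a = Λ.r b) : initSeg (Λ.comp a b h) (Λ.d a) = a := by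
  rw [(init_tail_comp_of_le h le_rfl).1, (init_tail_self a).1]

theorem eq_idPath_of_d_eq_zero {p : Λ.Path} (h : Λ.d p = 0) : p = Λ.idPath (Λ.r p) := by
  have h₁ := init_tail_eq_of_comp_eq (n := 0) (by simp [Λ.d_idPath]) (Λ.id_comp p)
  have h₂ := (init_tail_self p).1
  rw [h] at h₂
  rw [← h₁.1, h₂]

theorem tail_zero (p : Λ.Path) : tail p 0 = p :=
  (init_tail_eq_of_comp_eq (n := 0) (by simp [Λ.d_idPath]) (Λ.id_comp p)).2

theorem init_init (p : Λ.Path) {m n : Fin k → ℕ} (h : n ≤ m) : initSeg (initSeg p m) n = initSeg p n := by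
  have h' : Λ.comp (initSeg (initSeg p m) n) (Λ.comp (tail (initSeg p m) n) (tail p m)
      ((s_tail _ _).trans (s_init p m))) ((s_init _ _).trans (Λ.r_comp _ _ _).symm) = p := by
    rw [← Λ.assoc _ _ _ (s_init _ _)]
    exact (comp_congr (init_comp_tail _ n) rfl _).trans (init_comp_tail p m)
  refine (init_tail_eq_of_comp_eq ?_ h').1.symm
  rw [d_init, d_init, inf_assoc, inf_eq_right.2 h]

theorem tail_tail_add (p : Λ.Path) {m n : Fin k → ℕ} (h : m ≤ Λ.d p) :
    initSeg (tail p m) n = tail (initSeg p (m + n)) m ∧ tail (tail p m) n = tail p (m + n) := by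
  have hm : Λ.d (initSeg p m) = m := d_init_of_le h
  have h₁ := init_tail_comp_add (s_init p m) n
  rw [hm] at h₁
  simp only [init_comp_tail] at h₁
  refine ⟨?_, h₁.2.symm⟩
  rw [h₁.1, (init_tail_comp_of_le _ hm.ge).2]
  have h₂ := (init_tail_self (initSeg p m)).2
  rw [hm] at h₂
  refine (Λ.id_comp _).symm.trans (comp_congr ?_ rfl _)
  rw [h₂, r_init, s_init]

end Factorization

/-! ### Infinite paths that avoid a set of vertices -/

section AvoidingPath

variable {k : ℕ} {Λ : KGraph.{u} k}

/-- An infinite path, given by its initial segments, none of which ends in `H`. -/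
@[ext]
structure AvoidingPath (Λ : KGraph.{u} k) (H : Set Λ.Vertex) where
  seq : (Fin k → ℕ) → Λ.Path
  d_seq : ∀ n, Λ.d (seq n) = n
  init_seq : ∀ {n m}, n ≤ m → initSeg (seq m) n = seq n
  s_seq : ∀ n, Λ.s (seq n) ∉ H

namespace AvoidingPath

variable {H : Set Λ.Vertex}

/-- The range of an infinite path. -/
def vertex (x : Λ.AvoidingPath H) : Λ.Vertex := Λ.r (x.seq 0)

theorem r_seq (x : Λ.AvoidingPath H) (n : Fin k → ℕ) : Λ.r (x.seq n) = x.vertex := by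
  rw [vertex, ← x.init_seq (zero_le : 0 ≤ n), r_init]

theorem s_seq_zero (x : Λ.AvoidingPath H) : Λ.s (x.seq 0) = x.vertex := by
  have := eq_idPath_of_d_eq_zero (x.d_seq 0)
  rw [this, Λ.s_idPath]; rfl

theorem seq_zero (x : Λ.AvoidingPath H) : x.seq 0 = Λ.idPath x.vertex :=
  eq_idPath_of_d_eq_zero (x.d_seq 0)

/-- The degrees above `m` are cofinal in `ℕᵏ`, and each segment determines all shorter ones. -/
theorem ext_add {x y : Λ.AvoidingPath H} (m : Fin k → ℕ) (h : ∀ n, x.seq (m + n) = y.seq (m + n)) :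
    x = y := by
  ext n
  rw [← x.init_seq (le_add_self : n ≤ m + n), h, y.init_seq le_add_self]

/-- The shift map on infinite paths. -/
noncomputable def shift (x : Λ.AvoidingPath H) (l : Fin k → ℕ) : Λ.AvoidingPath H where
  seq n := tail (x.seq (l + n)) l
  d_seq n := by rw [d_tail, x.d_seq, add_tsub_cancel_left]
  init_seq {n m} h := by
    rw [(tail_tail_add _ (by rw [x.d_seq]; exact le_self_add)).1,
      x.init_seq (add_le_add_right h l)]
  s_seq n := by rw [s_tail]; exact x.s_seq _

theorem shift_seq (x : Λ.AvoidingPath H) (l n : Fin k → ℕ) :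
    (x.shift l).seq n = tail (x.seq (l + n)) l := rfl

theorem s_seq_eq (x : Λ.AvoidingPath H) (l n : Fin k → ℕ) :
    Λ.s (x.seq l) = Λ.r ((x.shift l).seq n) := by
  rw [shift_seq, ← s_init, x.init_seq le_self_add]

theorem vertex_shift (x : Λ.AvoidingPath H) (l : Fin k → ℕ) :
    (x.shift l).vertex = Λ.s (x.seq l) := (x.s_seq_eq l 0).symm

theorem seq_add (x : Λ.AvoidingPath H) (l n : Fin k → ℕ) :
    x.seq (l + n) = Λ.comp (x.seq l) ((x.shift l).seq n) (x.s_seq_eq l n) :=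
  (init_comp_tail _ l).symm.trans (comp_congr (x.init_seq le_self_add) rfl _)

theorem shift_zero (x : Λ.AvoidingPath H) : x.shift 0 = x := by
  ext n
  rw [shift_seq, tail_zero, zero_add]

theorem shift_shift (x : Λ.AvoidingPath H) (l m : Fin k → ℕ) :
    (x.shift l).shift m = x.shift (l + m) := by
  ext n
  rw [shift_seq, shift_seq, shift_seq, (tail_tail_add _ (by rw [x.d_seq]; exact le_self_add)).2,
    add_assoc]

theorem concat_aux (x : Λ.AvoidingPath H) (p : Λ.Path) (h : Λ.s p = x.vertex)
    {n m : Fin k → ℕ} (hnm : n ≤ m) :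
    initSeg (Λ.comp p (x.seq m) (h.trans (x.r_seq m).symm)) (Λ.d p + n) =
      Λ.comp p (x.seq n) (h.trans (x.r_seq n).symm) := by
  rw [(init_tail_comp_add _ n).1]
  exact comp_congr rfl (x.init_seq hnm) _

/-- The infinite path `p x`. -/
noncomputable def concat (hH : Λ.IsHereditary H) (x : Λ.AvoidingPath H) (p : Λ.Path)
    (h : Λ.s p = x.vertex) : Λ.AvoidingPath H where
  -- The path `p (x.seq n)` has degree `d p + n`, enough to be cut at `n` without comparing `n` with
  -- `d p`.
  seq n := initSeg (Λ.comp p (x.seq n) (h.trans (x.r_seq n).symm)) n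
  d_seq n := d_init_of_le (by rw [Λ.d_comp, x.d_seq]; exact le_add_self)
  init_seq {n m} hnm := by
    rw [init_init _ hnm, ← init_init _ (le_add_self : n ≤ Λ.d p + n), concat_aux x p h hnm]
  s_seq n hn := by
    -- If the segment ended in `H`, heredity along the remaining tail would put the end of `x.seq n`
    -- in `H`.
    rw [s_init] at hn
    have := hH _ hn
    rw [s_tail, Λ.s_comp] at this
    exact x.s_seq n this

theorem concat_seq_add (hH : Λ.IsHereditary H) (x : Λ.AvoidingPath H) (p : Λ.Path)
    (h : Λ.s p = x.vertex) (n : Fin k → ℕ) :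
    (x.concat hH p h).seq (Λ.d p + n) = Λ.comp p (x.seq n) (h.trans (x.r_seq n).symm) :=
  concat_aux x p h le_add_self

theorem concat_seq_d (hH : Λ.IsHereditary H) (x : Λ.AvoidingPath H) (p : Λ.Path)
    (h : Λ.s p = x.vertex) : (x.concat hH p h).seq (Λ.d p) = p := by
  rw [← AvoidingPath.init_seq _ (le_self_add : Λ.d p ≤ Λ.d p + 0), concat_seq_add, init_comp_left]

theorem vertex_concat (hH : Λ.IsHereditary H) (x : Λ.AvoidingPath H) (p : Λ.Path)
    (h : Λ.s p = x.vertex) : (x.concat hH p h).vertex = Λ.r p := by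
  rw [← r_seq _ (Λ.d p), concat_seq_d]

theorem shift_concat (hH : Λ.IsHereditary H) (x : Λ.AvoidingPath H) (p : Λ.Path)
    (h : Λ.s p = x.vertex) : (x.concat hH p h).shift (Λ.d p) = x := by
  ext n
  rw [shift_seq, concat_seq_add, (init_tail_comp_of_le _ le_rfl).2]
  refine (comp_congr ?_ rfl _).trans (Λ.id_comp _)
  rw [(init_tail_self p).2, h, x.r_seq]

theorem concat_shift (hH : Λ.IsHereditary H) (x : Λ.AvoidingPath H) (p : Λ.Path)
    (hp : x.seq (Λ.d p) = p) (h : Λ.s p = (x.shift (Λ.d p)).vertex) :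
    (x.shift (Λ.d p)).concat hH p h = x := by
  refine ext_add (Λ.d p) fun n => ?_
  rw [concat_seq_add, seq_add]
  exact comp_congr hp.symm rfl _

theorem seq_d_comp_iff (x : Λ.AvoidingPath H) (p q : Λ.Path) (h : Λ.s p = Λ.r q) :
    x.seq (Λ.d (Λ.comp p q h)) = Λ.comp p q h ↔
      x.seq (Λ.d p) = p ∧ (x.shift (Λ.d p)).seq (Λ.d q) = q := by
  rw [Λ.d_comp, seq_add]
  refine ⟨fun e => comp_injective (x.d_seq _) e, fun e => comp_congr e.1 e.2 _⟩

/-- The `k`-graph morphism given by an infinite path. -/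
noncomputable def toInfinitePath (x : Λ.AvoidingPath H) : Λ.InfinitePath where
  onVertex n := Λ.s (x.seq n)
  onPath p := tail (x.seq p.1.2) p.1.1
  map_r p := by
    rw [← s_init, x.init_seq p.2]; rfl
  map_s p := s_tail _ _
  map_id (n : Fin k → ℕ) := by
    have := (init_tail_self (x.seq n)).2
    rw [x.d_seq] at this
    exact this
  map_comp := by
    rintro ⟨⟨a, b⟩, hab⟩ ⟨⟨b', c⟩, hbc⟩ h
    obtain rfl : b = b' := h
    have e : x.seq c = Λ.comp (x.seq b) (tail (x.seq c) b)
        (by rw [← s_init, x.init_seq hbc]) :=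
      (init_comp_tail (x.seq c) b).symm.trans (comp_congr (x.init_seq hbc) rfl _)
    change tail (x.seq c) a = _
    conv_lhs => rw [e]
    exact (init_tail_comp_of_le _ (hab.trans (x.d_seq b).ge)).2
  map_d p := by
    rw [d_tail, x.d_seq]; rfl

end AvoidingPath

/-- Prolonging a path step by step with a choice function `f` for the next segment. -/
noncomputable def prolong (f : ∀ a : Λ.Vertex, {p : Λ.Path // Λ.r p = a}) (a : Λ.Vertex) :
    ℕ → Λ.Path
  | 0 => Λ.idPath a
  | j + 1 => Λ.comp (prolong f a j) (f (Λ.s (prolong f a j))).1 (f _).2.symm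

/-- By saturation, every vertex outside `H` emits a path of degree `(1, …, 1)` ending outside `H`.
Iteration gives paths of all diagonal degrees, each extending the previous one; other segments are
cut from these, and end outside `H` by heredity. -/
theorem exists_avoidingPath {H : Set Λ.Vertex} (hΛ : Λ.NoSources) (hH : Λ.IsHereditary H)
    (hs : Λ.IsSaturated H) {a : Λ.Vertex} (ha : a ∉ H) : ∃ x : Λ.AvoidingPath H, x.vertex = a := by
  have step : ∀ b : Λ.Vertex, ∃ p : {p : Λ.Path // Λ.r p = b}, Λ.d p = 1 ∧ (b ∉ H → Λ.s p ∉ H) := by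
    intro b
    by_cases hb : b ∈ H
    · obtain ⟨p, hp⟩ := hΛ b 1
      exact ⟨⟨p, hp.1⟩, hp.2, fun h => absurd hb h⟩
    · by_contra! hc
      refine hb (hs b 1 ?_)
      rintro _ ⟨p, hp, rfl⟩
      exact (hc ⟨p, hp.1⟩ hp.2).2
  choose f hf hfH using step
  have hd : ∀ j, Λ.d (prolong f a j) = fun _ => j := by
    intro j
    induction j with
    | zero => exact Λ.d_idPath a
    | succ j ih => rw [prolong, Λ.d_comp, ih, hf]; rfl
  have hsH : ∀ j, Λ.s (prolong f a j) ∉ H := by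
    intro j
    induction j with
    | zero => rwa [prolong, Λ.s_idPath]
    | succ j ih => rw [prolong, Λ.s_comp]; exact hfH _ ih
  have hinit : ∀ i j, i ≤ j → initSeg (prolong f a j) (fun _ => i) = prolong f a i := by
    intro i j hij
    induction j, hij using Nat.le_induction with
    | base => rw [← hd i, (init_tail_self _).1]
    | succ j hij ih =>
      rw [prolong, (init_tail_comp_of_le _ (by rw [hd]; exact fun _ => hij)).1, ih]
  -- The coordinate sum serves as diagonal length: it bounds every coordinate and is monotone in
  -- `n`.
  have hle : ∀ n : Fin k → ℕ, n ≤ fun _ => ∑ i, n i := fun n i =>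
    Finset.single_le_sum (f := n) (fun _ _ => Nat.zero_le _) (Finset.mem_univ i)
  refine ⟨⟨fun n => initSeg (prolong f a (∑ i, n i)) n, fun n => ?_, ?_, fun n hn => ?_⟩, ?_⟩
  · exact d_init_of_le (by rw [hd]; exact hle n)
  · intro n m hnm
    rw [init_init _ hnm, ← hinit _ _ (Finset.sum_le_sum fun i _ => hnm i), init_init _ (hle n)]
  · rw [s_init] at hn
    have := hH _ hn
    rw [s_tail] at this
    exact hsH _ this
  · change Λ.r (initSeg (prolong f a (∑ i : Fin k, (0 : Fin k → ℕ) i)) 0) = a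
    rw [r_init]
    simp [prolong, Λ.r_idPath]

end AvoidingPath

/-! ### Cofinality and hereditary saturated sets -/

section Cofinal

variable {k : ℕ} {Λ : KGraph.{u} k}

theorem isSaturated_empty (hΛ : Λ.NoSources) : Λ.IsSaturated ∅ := by
  intro a n h
  obtain ⟨p, hp⟩ := hΛ a n
  exact Set.notMem_empty _ (h ⟨p, hp, rfl⟩)

theorem isHereditary_empty : Λ.IsHereditary ∅ := fun _ h => h

theorem Cofinal.eq_empty_or_univ (hc : Λ.Cofinal) (hΛ : Λ.NoSources) {H : Set Λ.Vertex}
    (hH : Λ.IsHereditary H) (hs : Λ.IsSaturated H) : H = ∅ ∨ H = Set.univ := by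
  by_contra! h
  obtain ⟨b, hb⟩ := h.1
  obtain ⟨a, ha⟩ := (Set.ne_univ_iff_exists_notMem H).1 h.2
  obtain ⟨x, -⟩ := exists_avoidingPath hΛ hH hs ha
  obtain ⟨n, p, hp, hn⟩ := hc x.toInfinitePath b
  have : Λ.s p ∈ H := hH p (hp ▸ hb)
  rw [hn] at this
  exact x.s_seq n this

theorem cofinal_of_eq_empty_or_univ
    (h : ∀ H : Set Λ.Vertex, Λ.IsHereditary H → Λ.IsSaturated H → H = ∅ ∨ H = Set.univ) :
    Λ.Cofinal := by
  intro x a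
  by_contra hc
  -- The vertices from which no path leads to `x`.
  let H : Set Λ.Vertex := {b | ¬ ∃ n, ∃ p, Λ.r p = b ∧ Λ.s p = x.onVertex n}
  have hH : Λ.IsHereditary H := by
    rintro q hq ⟨n, p, hp, hn⟩
    exact hq ⟨n, Λ.comp q p hp.symm, Λ.r_comp _ _ _, (Λ.s_comp _ _ _).trans hn⟩
  have hs : Λ.IsSaturated H := by
    rintro b m hb ⟨(n : Fin k → ℕ), p, rfl, hn⟩
    -- The path `p` from `b` to `x` may be too short to have a segment of degree `m`; following `x`
    -- for a further `m` repairs this. The segment then ends at a vertex that still reaches `x`,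
    -- against the assumption on `b`.
    let q : (gridGraph k).Path := ⟨(n, n + m), fun i => Nat.le_add_right _ _⟩
    let t := Λ.comp p (x.onPath q) (hn.trans (x.map_r q).symm)
    have hm : m ≤ Λ.d t := by
      intro i
      have h₁ : (gridGraph k).d q i = n i + m i - n i := rfl
      have h₂ := congrFun (Λ.d_comp p (x.onPath q) (hn.trans (x.map_r q).symm)) i
      rw [x.map_d, Pi.add_apply, h₁] at h₂
      change _ ≤ Λ.d (Λ.comp p (x.onPath q) _) i
      omega
    have := hb ⟨initSeg t m, ⟨(r_init t m).trans (Λ.r_comp _ _ _), d_init_of_le hm⟩, rfl⟩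
    exact this ⟨n + m, tail t m, (s_init t m).symm,
      (s_tail t m).trans ((Λ.s_comp _ _ _).trans (x.map_s q))⟩
  have h₀ : x.onVertex (0 : Fin k → ℕ) ∉ H := fun h₀ =>
    h₀ ⟨(0 : Fin k → ℕ), Λ.idPath _, Λ.r_idPath _, Λ.s_idPath _⟩
  rcases h H hH hs with h | h
  · exact (h ▸ Set.notMem_empty a : a ∉ H) hc
  · exact h₀ (h ▸ Set.mem_univ _)

end Cofinal

end KGraph

namespace KGraph

/-! ### Reduction to the degrees `e_i` -/

section SingleDegree

variable {k : ℕ} {Λ : KGraph.{u} k}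

theorem degree_induction {P : (Fin k → ℕ) → Prop} (zero : P 0)
    (add_single : ∀ n i, P n → P (n + Pi.single i 1)) (n : Fin k → ℕ) : P n := by
  induction hN : ∑ i, n i generalizing n with
  | zero =>
    have : n = 0 := by
      funext i
      exact Finset.sum_eq_zero_iff.1 hN i (Finset.mem_univ i)
    exact this ▸ zero
  | succ N ih =>
    obtain ⟨i, -, hi⟩ := Finset.exists_ne_zero_of_sum_ne_zero (hN.trans_ne N.succ_ne_zero)
    have hn : n - Pi.single i 1 + Pi.single i 1 = n := by
      refine tsub_add_cancel_of_le fun j => ?_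
      by_cases hj : j = i
      · subst hj; simpa using Nat.one_le_iff_ne_zero.2 hi
      · simp [hj]
    rw [← hn]
    refine add_single _ i (ih _ ?_)
    rw [← hn] at hN
    simp only [Pi.add_apply, Finset.sum_add_distrib, Finset.sum_pi_single', Finset.mem_univ,
      if_true] at hN
    omega

/-- The relations of the talented monoid see only paths of degree `e_i`; this and the analogue for
saturation pass to all degrees by factoring paths. -/
theorem isHereditary_of_single {H : Set Λ.Vertex}
    (h : ∀ i p, Λ.d p = Pi.single i 1 → Λ.r p ∈ H → Λ.s p ∈ H) : Λ.IsHereditary H := by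
  suffices ∀ n p, Λ.d p = n → Λ.r p ∈ H → Λ.s p ∈ H from fun p => this _ p rfl
  intro n
  induction n using degree_induction with
  | zero =>
    intro p hp hr
    rw [eq_idPath_of_d_eq_zero hp, Λ.s_idPath]
    exact hr
  | add_single n i ih =>
    intro p hp hr
    rw [← s_tail p n]
    refine h i _ (by rw [d_tail, hp, add_tsub_cancel_left]) ?_
    rw [← s_init]
    exact ih _ (d_init_of_le (hp ▸ le_self_add)) (by rwa [r_init])

theorem isSaturated_of_single {H : Set Λ.Vertex}
    (h : ∀ (a : Λ.Vertex) (i : Fin k), Λ.s '' Λ.pathsFrom a (Pi.single i 1) ⊆ H → a ∈ H) :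
    Λ.IsSaturated H := by
  intro a n
  induction n using degree_induction with
  | zero =>
    intro hs
    exact hs ⟨Λ.idPath a, ⟨Λ.r_idPath a, Λ.d_idPath a⟩, Λ.s_idPath a⟩
  | add_single n i ih =>
    intro hs
    refine ih ?_
    rintro _ ⟨p, hp, rfl⟩
    refine h _ i ?_
    rintro _ ⟨q, hq, rfl⟩
    exact hs ⟨Λ.comp p q hq.1.symm, ⟨(Λ.r_comp _ _ _).trans hp.1,
      by rw [Λ.d_comp, hp.2, hq.2]⟩, Λ.s_comp _ _ _⟩

end SingleDegree

/-! ### Order ideals of the talented monoid -/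

section Talented

variable {k : ℕ} {Λ : KGraph.{u} k}

/-- The vectors all of whose symbols are based at vertices in `H`. -/
def supportedOn (H : Set Λ.Vertex) : AddSubmonoid Λ.FreeTalented where
  carrier := {f | ∀ b, f b ≠ 0 → b.1 ∈ H}
  zero_mem' b hb := absurd rfl hb
  add_mem' {f g} hf hg b hb := by
    by_cases h : f b = 0
    · exact hg b fun h' => hb (by simp [h, h'])
    · exact hf b h

/-- Coefficients are natural numbers, so nothing cancels; this is the source of the order ideal
property. -/
theorem add_mem_supportedOn {H : Set Λ.Vertex} {f g : Λ.FreeTalented} :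
    f + g ∈ supportedOn H ↔ f ∈ supportedOn H ∧ g ∈ supportedOn H := by
  refine ⟨fun h => ⟨fun b hb => h b ?_, fun b hb => h b ?_⟩, fun h => add_mem h.1 h.2⟩ <;>
  · rw [Finsupp.add_apply]; omega

theorem single_mem_supportedOn {H : Set Λ.Vertex} {b : Λ.Vertex × (Fin k → ℤ)} :
    Finsupp.single b 1 ∈ supportedOn H ↔ b.1 ∈ H := by
  refine ⟨fun h => h b (by simp), fun h c hc => ?_⟩
  rw [Finsupp.single_apply_ne_zero] at hc
  rwa [hc.1]

theorem sum_mem_supportedOn {ι : Type*} {H : Set Λ.Vertex} (s : Finset ι)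
    (f : ι → Λ.FreeTalented) :
    ∑ i ∈ s, f i ∈ supportedOn H ↔ ∀ i ∈ s, f i ∈ supportedOn H := by
  classical
  induction s using Finset.induction_on with
  | empty => simp [zero_mem]
  | insert a s ha ih => rw [Finset.sum_insert ha, add_mem_supportedOn, ih]; simp

variable [Λ.RowFinite]

theorem mem_pathsFinset {a : Λ.Vertex} {n : Fin k → ℕ} {p : Λ.Path} :
    p ∈ Λ.pathsFinset a n ↔ Λ.r p = a ∧ Λ.d p = n := by
  simp [pathsFinset, pathsFrom]

variable (Λ) in
/-- The quotient map onto the talented monoid. -/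
noncomputable def talentedMk : Λ.FreeTalented →+ Λ.TalentedMonoid := Λ.talentedCon.mk'

theorem talentedMk_surjective : Function.Surjective Λ.talentedMk := AddCon.mk'_surjective

theorem talentedMk_eq_iff {f g : Λ.FreeTalented} :
    Λ.talentedMk f = Λ.talentedMk g ↔ Λ.talentedCon f g := AddCon.eq _

/-- The generator `a(n)` of the talented monoid. -/
noncomputable def talentedVertex (a : Λ.Vertex) (n : Fin k → ℤ) : Λ.TalentedMonoid :=
  Λ.talentedMk (Finsupp.single (a, n) 1)

theorem smul_talentedVertex (m : Multiplicative (Fin k → ℤ)) (a : Λ.Vertex) (n : Fin k → ℤ) :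
    m • talentedVertex a n = talentedVertex a (n + m.toAdd) :=
  congrArg Λ.talentedMk (Finsupp.mapDomain_single)

theorem talentedVertex_eq_sum (hΛ : Λ.NoSources) (a : Λ.Vertex) (n : Fin k → ℤ) (i : Fin k) :
    talentedVertex a n = ∑ p ∈ Λ.pathsFinset a (Pi.single i 1),
      talentedVertex (Λ.s p) (n + Pi.single i 1) := by
  unfold talentedVertex
  rw [← map_sum, talentedMk_eq_iff]
  exact AddConGen.Rel.of _ _ (.rel a n i (hΛ _ _))

theorem talentedMonoid_induction {P : Λ.TalentedMonoid → Prop} (zero : P 0)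
    (add : ∀ x y, P x → P y → P (x + y)) (vertex : ∀ a n, P (talentedVertex a n))
    (x : Λ.TalentedMonoid) : P x := by
  obtain ⟨f, rfl⟩ := talentedMk_surjective x
  induction f using Finsupp.induction_linear with
  | zero => rwa [map_zero]
  | add f g hf hg => rw [map_add]; exact add _ _ hf hg
  | single b c =>
    induction c with
    | zero => rwa [Finsupp.single_zero, map_zero]
    | succ c ih => rw [Finsupp.single_add, map_add]; exact add _ _ ih (vertex b.1 b.2)

/-- Agreeing on membership in `supportedOn H` is itself an additive congruence. It contains each
defining relation: heredity gives one implication, saturation the other. -/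
theorem mem_supportedOn_congr {H : Set Λ.Vertex} (hH : Λ.IsHereditary H) (hs : Λ.IsSaturated H)
    {f g : Λ.FreeTalented} (h : Λ.talentedCon f g) : f ∈ supportedOn H ↔ g ∈ supportedOn H := by
  let C : AddCon Λ.FreeTalented :=
    { r := fun f g => f ∈ supportedOn H ↔ g ∈ supportedOn H
      iseqv := ⟨fun _ => Iff.rfl, Iff.symm, Iff.trans⟩
      add' := fun h h' => by rw [add_mem_supportedOn, add_mem_supportedOn, h, h'] }
  have key : Λ.talentedCon ≤ C := by
    refine AddCon.addConGen_le.2 ?_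
    rintro _ _ ⟨a, n, i, -⟩
    change _ ↔ _
    simp only [sum_mem_supportedOn, single_mem_supportedOn, mem_pathsFinset]
    refine ⟨fun ha p hp => hH p (hp.1 ▸ ha), fun h => hs a (Pi.single i 1) ?_⟩
    rintro _ ⟨p, hp, rfl⟩
    exact h p hp
  exact key h

theorem talentedMk_mem_map_supportedOn {H : Set Λ.Vertex} (hH : Λ.IsHereditary H)
    (hs : Λ.IsSaturated H) {f : Λ.FreeTalented} :
    Λ.talentedMk f ∈ (supportedOn H).map Λ.talentedMk ↔ f ∈ supportedOn H := by
  refine ⟨?_, fun h => ⟨f, h, rfl⟩⟩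
  rintro ⟨g, hg, e⟩
  exact (mem_supportedOn_congr hH hs (talentedMk_eq_iff.1 e)).1 hg

theorem talentedVertex_mem_map_supportedOn {H : Set Λ.Vertex} (hH : Λ.IsHereditary H)
    (hs : Λ.IsSaturated H) {a : Λ.Vertex} {n : Fin k → ℤ} :
    talentedVertex a n ∈ (supportedOn H).map Λ.talentedMk ↔ a ∈ H :=
  (talentedMk_mem_map_supportedOn hH hs).trans single_mem_supportedOn

theorem isGammaOrderIdeal_map_supportedOn {H : Set Λ.Vertex} (hH : Λ.IsHereditary H)
    (hs : Λ.IsSaturated H) :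
    IsGammaOrderIdeal (Multiplicative (Fin k → ℤ)) ((supportedOn H).map Λ.talentedMk) where
  down := by
    rintro x _ ⟨z, rfl⟩ h
    obtain ⟨f, rfl⟩ := talentedMk_surjective x
    obtain ⟨g, rfl⟩ := talentedMk_surjective z
    rw [← map_add, talentedMk_mem_map_supportedOn hH hs, add_mem_supportedOn] at h
    exact (talentedMk_mem_map_supportedOn hH hs).2 h.1
  smul_mem := by
    rintro m _ ⟨f, hf, rfl⟩
    refine ⟨Λ.freeShift m.toAdd f, ?_, rfl⟩
    intro b hb
    classical
    obtain ⟨c, hc, rfl⟩ := Finset.mem_image.1 (Finsupp.mapDomain_support (Finsupp.mem_support_iff.2 hb))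
    exact hf c (Finsupp.mem_support_iff.1 hc)

theorem map_supportedOn_empty :
    (supportedOn (∅ : Set Λ.Vertex)).map Λ.talentedMk = ⊥ := by
  rw [eq_bot_iff]
  rintro _ ⟨f, hf, rfl⟩
  have : f = 0 := by
    ext b
    by_contra hb
    exact hf b hb
  rw [this, map_zero]
  exact zero_mem _

/-- The case `H = ∅`, which is saturated because there are no sources. -/
theorem talentedVertex_ne_zero (hΛ : Λ.NoSources) (a : Λ.Vertex) (n : Fin k → ℤ) :
    talentedVertex a n ≠ 0 := by
  rw [Ne, ← AddSubmonoid.mem_bot, ← map_supportedOn_empty,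
    talentedVertex_mem_map_supportedOn isHereditary_empty (isSaturated_empty hΛ)]
  exact Set.notMem_empty a

theorem isConicalMonoid_talentedMonoid (hΛ : Λ.NoSources) : IsConicalMonoid Λ.TalentedMonoid := by
  intro x z h
  have := (isGammaOrderIdeal_map_supportedOn isHereditary_empty (isSaturated_empty hΛ)).down x 0
    ⟨z, h⟩ (zero_mem _)
  rwa [map_supportedOn_empty, AddSubmonoid.mem_bot] at this

/-- Invariance under the action makes the degree of a symbol irrelevant, so an ideal is recorded by
vertices alone. -/
theorem orderIdeal_talentedVertex_mem {J : AddSubmonoid Λ.TalentedMonoid}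
    (hJ : IsGammaOrderIdeal (Multiplicative (Fin k → ℤ)) J) {a : Λ.Vertex} {n : Fin k → ℤ}
    (h : talentedVertex a n ∈ J) (m : Fin k → ℤ) : talentedVertex a m ∈ J := by
  have := hJ.smul_mem (Multiplicative.ofAdd (m - n)) _ h
  rwa [smul_talentedVertex, toAdd_ofAdd, add_sub_cancel] at this

theorem orderIdeal_mem_of_sum_mem {J : AddSubmonoid Λ.TalentedMonoid}
    (hJ : IsGammaOrderIdeal (Multiplicative (Fin k → ℤ)) J) {ι : Type*} {s : Finset ι} {f : ι → Λ.TalentedMonoid}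
    (h : ∑ i ∈ s, f i ∈ J) : ∀ i ∈ s, f i ∈ J := by
  classical
  intro i hi
  exact hJ.down _ _ ⟨_, (Finset.add_sum_erase s f hi).symm⟩ h

theorem orderIdeal_isHereditary {J : AddSubmonoid Λ.TalentedMonoid}
    (hJ : IsGammaOrderIdeal (Multiplicative (Fin k → ℤ)) J) (hΛ : Λ.NoSources) :
    Λ.IsHereditary {a | talentedVertex a 0 ∈ J} := by
  refine isHereditary_of_single fun i p hp hr => ?_
  have hr : talentedVertex (Λ.r p) 0 ∈ J := hr
  rw [talentedVertex_eq_sum hΛ _ _ i] at hr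
  exact orderIdeal_talentedVertex_mem hJ
    (orderIdeal_mem_of_sum_mem hJ hr p (mem_pathsFinset.2 ⟨rfl, hp⟩)) 0

theorem orderIdeal_isSaturated {J : AddSubmonoid Λ.TalentedMonoid}
    (hJ : IsGammaOrderIdeal (Multiplicative (Fin k → ℤ)) J) (hΛ : Λ.NoSources) :
    Λ.IsSaturated {a | talentedVertex a 0 ∈ J} := by
  refine isSaturated_of_single fun a i h => ?_
  change talentedVertex a 0 ∈ J
  rw [talentedVertex_eq_sum hΛ _ _ i]
  exact sum_mem fun p hp =>
    orderIdeal_talentedVertex_mem hJ (h ⟨p, mem_pathsFinset.1 hp, rfl⟩) _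

theorem isSimpleGammaMonoid_iff [Nonempty Λ.Vertex] (hΛ : Λ.NoSources) :
    IsSimpleGammaMonoid (Multiplicative (Fin k → ℤ)) Λ.TalentedMonoid ↔
      ∀ H : Set Λ.Vertex, Λ.IsHereditary H → Λ.IsSaturated H → H = ∅ ∨ H = Set.univ := by
  constructor
  · intro h H hH hs
    rw [Set.eq_empty_iff_forall_notMem, Set.eq_univ_iff_forall]
    simp only [← talentedVertex_mem_map_supportedOn hH hs (n := 0)]
    rcases h.eq_bot_or_eq_top _ (isGammaOrderIdeal_map_supportedOn hH hs) with h | h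
    · rw [h]
      exact .inl fun a => talentedVertex_ne_zero hΛ a 0
    · rw [h]
      exact .inr fun a => trivial
  · intro h
    refine ⟨?_, isConicalMonoid_talentedMonoid hΛ, fun J hJ => ?_⟩
    · obtain ⟨a⟩ := ‹Nonempty Λ.Vertex›
      exact ⟨_, _, talentedVertex_ne_zero hΛ a 0⟩
    · rcases h _ (orderIdeal_isHereditary hJ hΛ) (orderIdeal_isSaturated hJ hΛ)
        with h | h
      · left
        rw [eq_bot_iff]
        intro x
        induction x using talentedMonoid_induction with
        | zero => exact fun _ => zero_mem _
        | add x y hx hy =>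
          intro hxy
          exact add_mem (hx (hJ.down x _ ⟨y, rfl⟩ hxy)) (hy (hJ.down y _ ⟨x, add_comm x y⟩ hxy))
        | vertex a n =>
          intro ha
          exact absurd (orderIdeal_talentedVertex_mem hJ ha 0)
            (Set.eq_empty_iff_forall_notMem.1 h a)
      · right
        rw [eq_top_iff]
        rintro x -
        induction x using talentedMonoid_induction with
        | zero => exact zero_mem _
        | add x y hx hy => exact add_mem hx hy
        | vertex a n =>
          exact orderIdeal_talentedVertex_mem hJ (Set.eq_univ_iff_forall.1 h a) n

end Talented

end KGraph

namespace KGraph.KPAlgebra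

variable {k : ℕ} {Λ : KGraph.{u} k} [Λ.RowFinite] {R : Type w} [CommRing R]

/-! ### Calculation rules in the Kumjian-Pask algebra -/

section Relations

theorem mk_eq_of_rel {a b : Λ.FreeKP R} (h : Λ.KPRel R a b) : mk Λ R a = mk Λ R b :=
  (RingCon.eq _).2 (RingConGen.Rel.of _ _ (by simpa using KPScaledRel.smul 1 h))

variable (R)

theorem s_idPath (a : Λ.Vertex) : s Λ R (Λ.idPath a) = p Λ R a := mk_eq_of_rel (.path_id a)

theorem sStar_idPath (a : Λ.Vertex) : sStar Λ R (Λ.idPath a) = p Λ R a :=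
  mk_eq_of_rel (.ghost_id a)

theorem p_mul_p_self (a : Λ.Vertex) : p Λ R a * p Λ R a = p Λ R a := mk_eq_of_rel (.kp1_self a)

theorem p_mul_p_ne {a b : Λ.Vertex} (h : a ≠ b) : p Λ R a * p Λ R b = 0 :=
  mk_eq_of_rel (.kp1_ne a b h)

theorem s_mul_s {q t : Λ.Path} (h : Λ.s q = Λ.r t) :
    s Λ R q * s Λ R t = s Λ R (Λ.comp q t h) := mk_eq_of_rel (.kp2_path q t h)

theorem sStar_mul_sStar {q t : Λ.Path} (h : Λ.s q = Λ.r t) :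
    sStar Λ R t * sStar Λ R q = sStar Λ R (Λ.comp q t h) := mk_eq_of_rel (.kp2_ghost q t h)

theorem p_mul_s (q : Λ.Path) : p Λ R (Λ.r q) * s Λ R q = s Λ R q :=
  mk_eq_of_rel (.kp2_range_path q)

theorem s_mul_p (q : Λ.Path) : s Λ R q * p Λ R (Λ.s q) = s Λ R q :=
  mk_eq_of_rel (.kp2_path_source q)

theorem p_mul_sStar (q : Λ.Path) : p Λ R (Λ.s q) * sStar Λ R q = sStar Λ R q :=
  mk_eq_of_rel (.kp2_source_ghost q)

theorem sStar_mul_p (q : Λ.Path) : sStar Λ R q * p Λ R (Λ.r q) = sStar Λ R q :=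
  mk_eq_of_rel (.kp2_ghost_range q)

theorem sStar_mul_s_self (q : Λ.Path) : sStar Λ R q * s Λ R q = p Λ R (Λ.s q) :=
  mk_eq_of_rel (.kp3_self q)

theorem sStar_mul_s_ne {q t : Λ.Path} (hd : Λ.d q = Λ.d t) (h : q ≠ t) :
    sStar Λ R q * s Λ R t = 0 := mk_eq_of_rel (.kp3_ne q t hd h)

theorem mk_sum {ι : Type*} (A : Finset ι) (f : ι → Λ.FreeKP R) :
    mk Λ R (∑ i ∈ A, f i) = ∑ i ∈ A, mk Λ R (f i) :=
  map_sum (⟨⟨mk Λ R, rfl⟩, fun _ _ => rfl⟩ : Λ.FreeKP R →+ Λ.KPAlgebra R) f A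

theorem p_eq_sum (a : Λ.Vertex) (n : Fin k → ℕ) :
    p Λ R a = ∑ q ∈ Λ.pathsFinset a n, s Λ R q * sStar Λ R q := by
  exact (mk_eq_of_rel (.kp4 a n)).trans (mk_sum R _ _)

theorem s_mul_s_ne {q t : Λ.Path} (h : Λ.s q ≠ Λ.r t) : s Λ R q * s Λ R t = 0 := by
  rw [← s_mul_p, ← p_mul_s R t, mul_assoc, ← mul_assoc (p Λ R _), p_mul_p_ne R h, zero_mul,
    mul_zero]

theorem sStar_mul_sStar_ne {q t : Λ.Path} (h : Λ.s q ≠ Λ.r t) :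
    sStar Λ R t * sStar Λ R q = 0 := by
  rw [← sStar_mul_p, ← p_mul_sStar R q, mul_assoc, ← mul_assoc (p Λ R _), p_mul_p_ne R h.symm,
    zero_mul, mul_zero]

/-- Inserting the fourth relation in the middle lengthens both paths by `n`. This makes degrees
comparable before multiplying, and equal before comparing monomials. -/
theorem s_mul_sStar_eq_sum {q t : Λ.Path} (h : Λ.s q = Λ.s t) (n : Fin k → ℕ) :
    s Λ R q * sStar Λ R t = ∑ e ∈ Λ.pathsFinset (Λ.s q) n,
      (s Λ R q * s Λ R e) * (sStar Λ R e * sStar Λ R t) := by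
  conv_lhs => rw [← p_mul_sStar R t, ← h, p_eq_sum R _ n, Finset.sum_mul, Finset.mul_sum]
  simp only [mul_assoc]

theorem sStar_mul_s_of_le {q t : Λ.Path} (h : Λ.d q ≤ Λ.d t) :
    sStar Λ R q * s Λ R t = s Λ R (tail t (Λ.d q)) ∨ sStar Λ R q * s Λ R t = 0 := by
  have e : sStar Λ R q * s Λ R t =
      sStar Λ R q * s Λ R (initSeg t (Λ.d q)) * s Λ R (tail t (Λ.d q)) := by
    rw [mul_assoc, s_mul_s R (s_init _ _), init_comp_tail]
  by_cases hq : q = initSeg t (Λ.d q)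
  · left
    have hr : Λ.s q = Λ.r (tail t (Λ.d q)) := by rw [← s_init, ← hq]
    rw [e, ← hq, sStar_mul_s_self, hr, p_mul_s]
  · right
    rw [e, sStar_mul_s_ne R (d_init_of_le h).symm hq, zero_mul]

theorem sStar_mul_s_of_ge {q t : Λ.Path} (h : Λ.d q ≤ Λ.d t) :
    sStar Λ R t * s Λ R q = sStar Λ R (tail t (Λ.d q)) ∨ sStar Λ R t * s Λ R q = 0 := by
  have e : sStar Λ R t * s Λ R q =
      sStar Λ R (tail t (Λ.d q)) * (sStar Λ R (initSeg t (Λ.d q)) * s Λ R q) := by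
    rw [← mul_assoc, sStar_mul_sStar R (s_init _ _), init_comp_tail]
  by_cases hq : initSeg t (Λ.d q) = q
  · left
    have hr : Λ.s q = Λ.r (tail t (Λ.d q)) := by rw [← s_init, hq]
    rw [e, hq, sStar_mul_s_self, hr, sStar_mul_p]
  · right
    rw [e, sStar_mul_s_ne R (d_init_of_le h) hq, mul_zero]

end Relations

/-! ### Vertex idempotents in an ideal -/

section Generators

variable (R) in
/-- A generator as an element of the Kumjian-Pask algebra. -/
noncomputable def gen (g : Λ.KPGen) : Λ.KPAlgebra R := mk Λ R (Λ.freeGen R g)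

theorem induction_on_gen {P : Λ.KPAlgebra R → Prop} (zero : P 0)
    (gen : ∀ (c : R) (g : Λ.KPGen), P (c • gen R g))
    (add : ∀ a b, P a → P b → P (a + b)) (mul : ∀ a b, P a → P b → P (a * b))
    (a : Λ.KPAlgebra R) : P a := by
  obtain ⟨a⟩ := a
  change P (mk Λ R a)
  have hgen : ∀ (c : R) (g : Λ.KPGen), P (mk Λ R (MonoidAlgebra.single (FreeSemigroup.of g) c)) := by
    intro c g
    have e : (MonoidAlgebra.single (FreeSemigroup.of g) c : Λ.FreeKP R) = c • Λ.freeGen R g := by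
      simp [freeGen]
    rw [e]
    exact gen c g
  induction a using MonoidAlgebra.induction_linear with
  | zero => exact zero
  | add a b ha hb => exact add _ _ ha hb
  | single w c =>
    induction w using FreeSemigroup.recOnMul generalizing c with
    | ih1 g => exact hgen c g
    | ih2 g w _ ih =>
      have e : (MonoidAlgebra.single (FreeSemigroup.of g * w) c : Λ.FreeKP R) =
          MonoidAlgebra.single (FreeSemigroup.of g) c * MonoidAlgebra.single w 1 := by simp
      rw [e]
      exact mul _ _ (hgen c g) (ih 1)

/-- The algebra need not have a unit, but each generator is fixed by right multiplication with some
vertex idempotent. -/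
theorem eq_top_of_forall_p_mem {I : TwoSidedIdeal (Λ.KPAlgebra R)} (h : ∀ a, p Λ R a ∈ I) :
    I = ⊤ := by
  refine top_unique fun a _ => ?_
  induction a using induction_on_gen with
  | zero => exact I.zero_mem
  | gen c g =>
    cases g with
    | vertex a =>
      have := I.mul_mem_left (c • p Λ R a) _ (h a)
      rwa [smul_mul_assoc, p_mul_p_self] at this
    | path q =>
      have := I.mul_mem_left (c • s Λ R q) _ (h (Λ.s q))
      rwa [smul_mul_assoc, s_mul_p] at this
    | ghost q =>
      have := I.mul_mem_left (c • sStar Λ R q) _ (h (Λ.r q))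
      rwa [smul_mul_assoc, sStar_mul_p] at this
  | add a b ha hb => exact I.add_mem (ha trivial) (hb trivial)
  | mul a b ha hb => exact I.mul_mem_left _ _ (hb trivial)

theorem isHereditary_p_mem (I : TwoSidedIdeal (Λ.KPAlgebra R)) :
    Λ.IsHereditary {a | p Λ R a ∈ I} := by
  intro q hq
  have := I.mul_mem_right _ (s Λ R q) (I.mul_mem_left (sStar Λ R q) _ hq)
  rwa [sStar_mul_p, sStar_mul_s_self] at this

theorem isSaturated_p_mem (I : TwoSidedIdeal (Λ.KPAlgebra R)) :
    Λ.IsSaturated {a | p Λ R a ∈ I} := by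
  intro a n h
  change p Λ R a ∈ I
  rw [p_eq_sum R a n]
  refine sum_mem fun q hq => ?_
  rw [← s_mul_p]
  exact I.mul_mem_right _ _ (I.mul_mem_left _ _ (h ⟨q, mem_pathsFinset.1 hq, rfl⟩))

end Generators

/-! ### Homogeneous elements, graded ideals and basic ideals -/

section Grading

theorem s_mul_sStar_mem_component {q t : Λ.Path} (h : Λ.s q = Λ.s t) {n : Fin k → ℤ}
    (hn : ∀ i, (Λ.d q i : ℤ) - Λ.d t i = n i) : s Λ R q * sStar Λ R t ∈ component Λ R n :=
  Submodule.subset_span ⟨q, t, h, funext hn, rfl⟩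

theorem p_mem_component (a : Λ.Vertex) : p Λ R a ∈ component Λ R 0 := by
  rw [← p_mul_p_self]
  nth_rw 1 [← s_idPath]
  rw [← sStar_idPath]
  exact s_mul_sStar_mem_component rfl fun i => sub_self _

theorem component_induction {n : Fin k → ℤ} {N : Submodule R (Λ.KPAlgebra R)}
    (f : Λ.KPAlgebra R →ₗ[R] Λ.KPAlgebra R)
    (h : ∀ q t : Λ.Path, Λ.s q = Λ.s t → (∀ i, (Λ.d q i : ℤ) - Λ.d t i = n i) →
      f (s Λ R q * sStar Λ R t) ∈ N) {b : Λ.KPAlgebra R} (hb : b ∈ component Λ R n) : f b ∈ N := by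
  suffices component Λ R n ≤ N.comap f from this hb
  refine Submodule.span_le.2 ?_
  rintro _ ⟨q, t, hqt, rfl, rfl⟩
  exact h q t hqt fun _ => rfl

theorem gen_mul_mem_component (g : Λ.KPGen) {n : Fin k → ℤ} {b : Λ.KPAlgebra R}
    (hb : b ∈ component Λ R n) : ∃ m, gen R g * b ∈ component Λ R m := by
  have hs : ∀ e, ∃ m, s Λ R e * b ∈ component Λ R m := by
    intro e
    refine ⟨fun i => Λ.d e i + n i,
      component_induction (LinearMap.mulLeft R (s Λ R e)) (fun q t h hn => ?_) hb⟩
    rw [LinearMap.mulLeft_apply, ← mul_assoc]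
    by_cases he : Λ.s e = Λ.r q
    · rw [s_mul_s R he]
      refine s_mul_sStar_mem_component ((Λ.s_comp _ _ _).trans h) fun i => ?_
      rw [Λ.d_comp, ← hn]
      push_cast [Pi.add_apply]
      ring
    · rw [s_mul_s_ne R he, zero_mul]
      exact zero_mem _
  cases g with
  | vertex a => rw [show gen R (.vertex a) = p Λ R a from rfl, ← s_idPath]; exact hs _
  | path e => exact hs e
  | ghost e =>
    refine ⟨fun i => n i - Λ.d e i,
      component_induction (LinearMap.mulLeft R (sStar Λ R e)) (fun q t h hn => ?_) hb⟩
    -- After lengthening by `d e`, every left factor has degree at least `d e`, so `s_{e*}` either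
    -- cancels against it or gives zero.
    rw [LinearMap.mulLeft_apply, s_mul_sStar_eq_sum R h (Λ.d e), Finset.mul_sum]
    refine sum_mem fun f hf => ?_
    obtain ⟨hr, hd⟩ := mem_pathsFinset.1 hf
    rw [s_mul_s R hr.symm, sStar_mul_sStar R (hr.trans h).symm, ← mul_assoc]
    have hle : Λ.d e ≤ Λ.d (Λ.comp q f hr.symm) := by
      rw [Λ.d_comp, hd]; exact le_add_self
    rcases sStar_mul_s_of_le R hle with h' | h'
    · rw [h']
      refine s_mul_sStar_mem_component (by rw [s_tail, Λ.s_comp, Λ.s_comp]) fun i => ?_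
      rw [d_tail, Λ.d_comp, Λ.d_comp, hd, add_tsub_cancel_right, ← hn]
      push_cast [Pi.add_apply]
      ring
    · rw [h', zero_mul]
      exact zero_mem _

theorem mul_gen_mem_component (g : Λ.KPGen) {n : Fin k → ℤ} {b : Λ.KPAlgebra R}
    (hb : b ∈ component Λ R n) : ∃ m, b * gen R g ∈ component Λ R m := by
  have hs : ∀ e, ∃ m, b * sStar Λ R e ∈ component Λ R m := by
    intro e
    refine ⟨fun i => n i - Λ.d e i,
      component_induction (LinearMap.mulRight R (sStar Λ R e)) (fun q t h hn => ?_) hb⟩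
    rw [LinearMap.mulRight_apply, mul_assoc]
    by_cases he : Λ.s e = Λ.r t
    · rw [sStar_mul_sStar R he]
      refine s_mul_sStar_mem_component (h.trans (Λ.s_comp _ _ _).symm) fun i => ?_
      rw [Λ.d_comp, ← hn]
      push_cast [Pi.add_apply]
      ring
    · rw [sStar_mul_sStar_ne R he, mul_zero]
      exact zero_mem _
  cases g with
  | vertex a => rw [show gen R (.vertex a) = p Λ R a from rfl, ← sStar_idPath]; exact hs _
  | ghost e => exact hs e
  | path e =>
    refine ⟨fun i => n i + Λ.d e i,
      component_induction (LinearMap.mulRight R (s Λ R e)) (fun q t h hn => ?_) hb⟩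
    rw [LinearMap.mulRight_apply, s_mul_sStar_eq_sum R h (Λ.d e), Finset.sum_mul]
    refine sum_mem fun f hf => ?_
    obtain ⟨hr, hd⟩ := mem_pathsFinset.1 hf
    rw [s_mul_s R hr.symm, sStar_mul_sStar R (hr.trans h).symm, mul_assoc]
    have hle : Λ.d e ≤ Λ.d (Λ.comp t f (hr.trans h).symm) := by
      rw [Λ.d_comp, hd]; exact le_add_self
    rcases sStar_mul_s_of_ge R hle with h' | h'
    · rw [h']
      refine s_mul_sStar_mem_component (by rw [s_tail, Λ.s_comp, Λ.s_comp]) fun i => ?_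
      rw [d_tail, Λ.d_comp, Λ.d_comp, hd, add_tsub_cancel_right, ← hn]
      push_cast [Pi.add_apply]
      ring
    · rw [h', mul_zero]
      exact zero_mem _

/-- The subgroup generated by the homogeneous elements of an ideal. -/
noncomputable def homogeneousClosure (I : TwoSidedIdeal (Λ.KPAlgebra R)) : AddSubgroup (Λ.KPAlgebra R) :=
  AddSubgroup.closure {b | b ∈ I ∧ ∃ n, b ∈ component Λ R n}

theorem mul_mem_homogeneousClosure (I : TwoSidedIdeal (Λ.KPAlgebra R)) (a : Λ.KPAlgebra R) :
    (∀ b ∈ homogeneousClosure I, a * b ∈ homogeneousClosure I) ∧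
      ∀ b ∈ homogeneousClosure I, b * a ∈ homogeneousClosure I := by
  induction a using induction_on_gen with
  | zero => simp [zero_mem]
  | add a b ha hb =>
    refine ⟨fun c hc => ?_, fun c hc => ?_⟩
    · rw [add_mul]; exact add_mem (ha.1 c hc) (hb.1 c hc)
    · rw [mul_add]; exact add_mem (ha.2 c hc) (hb.2 c hc)
  | mul a b ha hb =>
    refine ⟨fun c hc => ?_, fun c hc => ?_⟩
    · rw [mul_assoc]; exact ha.1 _ (hb.1 c hc)
    · rw [← mul_assoc]; exact hb.2 _ (ha.2 c hc)
  | gen c g =>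
    refine ⟨fun b hb => ?_, fun b hb => ?_⟩
    · suffices homogeneousClosure I ≤
        (homogeneousClosure I).comap (AddMonoidHom.mulLeft (c • gen R g)) from this hb
      refine (AddSubgroup.closure_le _).2 ?_
      rintro b ⟨hb, n, hn⟩
      obtain ⟨m, hm⟩ := gen_mul_mem_component g hn
      refine AddSubgroup.subset_closure ⟨I.mul_mem_left _ _ hb, m, ?_⟩
      rw [AddMonoidHom.coe_mulLeft, smul_mul_assoc]
      exact Submodule.smul_mem _ _ hm
    · suffices homogeneousClosure I ≤
        (homogeneousClosure I).comap (AddMonoidHom.mulRight (c • gen R g)) from this hb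
      refine (AddSubgroup.closure_le _).2 ?_
      rintro b ⟨hb, n, hn⟩
      obtain ⟨m, hm⟩ := mul_gen_mem_component g hn
      refine AddSubgroup.subset_closure ⟨I.mul_mem_right _ _ hb, m, ?_⟩
      rw [AddMonoidHom.mulRight_apply, mul_smul_comm]
      exact Submodule.smul_mem _ _ hm

variable (R) in
/-- The ideal generated by the `p_a` with `a ∈ H`. -/
noncomputable def vertexIdeal (H : Set Λ.Vertex) : TwoSidedIdeal (Λ.KPAlgebra R) :=
  TwoSidedIdeal.span (p Λ R '' H)

theorem p_mem_vertexIdeal {H : Set Λ.Vertex} {a : Λ.Vertex} (ha : a ∈ H) :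
    p Λ R a ∈ vertexIdeal R H := TwoSidedIdeal.subset_span ⟨a, ha, rfl⟩

/-- The homogeneous elements of the ideal generate a subgroup that is again an ideal and contains
the generators `p_a`, which have degree `0`. -/
theorem isGradedIdeal_vertexIdeal (H : Set Λ.Vertex) : IsGradedIdeal (vertexIdeal R H) := by
  let J : TwoSidedIdeal (Λ.KPAlgebra R) := TwoSidedIdeal.mk' (homogeneousClosure (vertexIdeal R H))
    (zero_mem _) add_mem neg_mem (fun h => (mul_mem_homogeneousClosure _ _).1 _ h)
    (fun h => (mul_mem_homogeneousClosure _ _).2 _ h)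
  have h : vertexIdeal R H ≤ J := by
    refine TwoSidedIdeal.span_le.2 ?_
    rintro _ ⟨a, ha, rfl⟩
    exact (TwoSidedIdeal.mem_mk' ..).2
      (AddSubgroup.subset_closure ⟨p_mem_vertexIdeal ha, 0, p_mem_component a⟩)
  exact fun a ha => (TwoSidedIdeal.mem_mk' ..).1 (h ha)

/-- Pairs of paths with common source, of degrees `m + n` and `m`. -/
def PathPair (Λ : KGraph.{u} k) (m : Fin k → ℕ) (n : Fin k → ℤ) : Type u :=
  {e : Λ.Path × Λ.Path //
    Λ.s e.1 = Λ.s e.2 ∧ Λ.d e.2 = m ∧ ∀ i, (Λ.d e.1 i : ℤ) - Λ.d e.2 i = n i}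

variable (R) in
/-- The monomial `s_q s_{t*}` of a pair of paths. -/
noncomputable def PathPair.monomial {m : Fin k → ℕ} {n : Fin k → ℤ} (e : PathPair Λ m n) :
    Λ.KPAlgebra R := s Λ R e.1.1 * sStar Λ R e.1.2

/-- Asking for all `m` above a bound, not just one, lets two summands be brought to the same ghost
degree. -/
theorem exists_forall_mem_span_monomial {n : Fin k → ℤ} {b : Λ.KPAlgebra R}
    (hb : b ∈ component Λ R n) : ∃ M, ∀ m, M ≤ m →
      b ∈ Submodule.span R (Set.range (PathPair.monomial R (Λ := Λ) (m := m) (n := n))) := by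
  refine Submodule.span_induction ?_ ⟨0, fun _ _ => zero_mem _⟩ ?_ ?_ hb
  · rintro _ ⟨q, t, h, rfl, rfl⟩
    refine ⟨Λ.d t, fun m hm => ?_⟩
    rw [s_mul_sStar_eq_sum R h (m - Λ.d t)]
    refine sum_mem fun f hf => ?_
    obtain ⟨hr, hd⟩ := mem_pathsFinset.1 hf
    rw [s_mul_s R hr.symm, sStar_mul_sStar R (hr.trans h).symm]
    refine Submodule.subset_span ⟨⟨(Λ.comp q f hr.symm, Λ.comp t f (hr.trans h).symm),
      (Λ.s_comp _ _ _).trans (Λ.s_comp _ _ _).symm, ?_, fun i => ?_⟩, rfl⟩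
    · rw [Λ.d_comp, hd, add_tsub_cancel_of_le hm]
    · rw [Λ.d_comp, Λ.d_comp]
      push_cast [Pi.add_apply]
      ring
  · rintro a b - - ⟨M, hM⟩ ⟨N, hN⟩
    exact ⟨M ⊔ N, fun m hm => add_mem (hM m (le_sup_left.trans hm)) (hN m (le_sup_right.trans hm))⟩
  · rintro c a - ⟨M, hM⟩
    exact ⟨M, fun m hm => Submodule.smul_mem _ _ (hM m hm)⟩

/-- With `m` and `n` fixed, both paths of a pair have prescribed degrees, so the third relation
separates distinct pairs. -/
theorem sStar_mul_monomial_mul_s {m : Fin k → ℕ} {n : Fin k → ℤ} [DecidableEq (PathPair Λ m n)]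
    (e f : PathPair Λ m n) :
    sStar Λ R e.1.1 * f.monomial R * s Λ R e.1.2 = if f = e then p Λ R (Λ.s e.1.1) else 0 := by
  obtain ⟨⟨q, t⟩, h, hd, hn⟩ := e
  obtain ⟨⟨q', t'⟩, h', hd', hn'⟩ := f
  dsimp only at h hd hn h' hd' hn' ⊢
  have ht : Λ.d t' = Λ.d t := hd'.trans hd.symm
  have hq : Λ.d q = Λ.d q' := by
    funext i
    have h₁ := hn i
    have h₂ := hn' i
    rw [ht] at h₂
    omega
  change sStar Λ R q * (s Λ R q' * sStar Λ R t') * s Λ R t = _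
  rw [← mul_assoc, mul_assoc (_ * _)]
  split_ifs with he
  · obtain ⟨rfl, rfl⟩ := Prod.ext_iff.1 (Subtype.ext_iff.1 he)
    dsimp only
    rw [sStar_mul_s_self, sStar_mul_s_self, ← h, p_mul_p_self]
  · by_cases hqq : q = q'
    · have htt : t' ≠ t := by
        rintro rfl
        subst hqq
        exact he rfl
      rw [sStar_mul_s_ne R ht htt, mul_zero]
    · rw [sStar_mul_s_ne R hq hqq, zero_mul]

theorem IsBasicIdeal.exists_p_mem_of_mem_component {I : TwoSidedIdeal (Λ.KPAlgebra R)}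
    (hI : IsBasicIdeal I) {b : Λ.KPAlgebra R} (hb : b ∈ I) (hb₀ : b ≠ 0) {n : Fin k → ℤ}
    (hn : b ∈ component Λ R n) : ∃ a, p Λ R a ∈ I := by
  classical
  obtain ⟨m, hm⟩ := exists_forall_mem_span_monomial hn
  obtain ⟨c, rfl⟩ := Finsupp.mem_span_range_iff_exists_finsupp.1 (hm m le_rfl)
  have hc : c ≠ 0 := by
    rintro rfl
    exact hb₀ Finsupp.sum_zero_index
  -- Compressing by the pair `e` leaves only `c e` times a vertex idempotent, which basicness then
  -- frees of its coefficient.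
  obtain ⟨e, he⟩ := Finsupp.ne_iff.1 hc
  refine ⟨Λ.s e.1.1, hI _ (c e) he ?_⟩
  have := I.mul_mem_right _ (s Λ R e.1.2) (I.mul_mem_left (sStar Λ R e.1.1) _ hb)
  rw [Finsupp.sum, Finset.mul_sum, Finset.sum_mul] at this
  simp only [mul_smul_comm, smul_mul_assoc, sStar_mul_monomial_mul_s] at this
  rw [Finset.sum_eq_single e] at this
  · simpa using this
  · intro f _ hf
    rw [if_neg hf, smul_zero]
  · intro h
    rw [Finsupp.notMem_support_iff.1 h, zero_smul]

theorem IsBasicIdeal.exists_p_mem {I : TwoSidedIdeal (Λ.KPAlgebra R)} (hg : IsGradedIdeal I)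
    (hI : IsBasicIdeal I) (h : I ≠ ⊥) : ∃ a, p Λ R a ∈ I := by
  by_contra hc
  refine h (bot_unique fun a ha => ?_)
  have h₀ : {b | b ∈ I ∧ ∃ n, b ∈ component Λ R n} ⊆ ((⊥ : AddSubgroup (Λ.KPAlgebra R)) : Set _) := by
    rintro b ⟨hb, n, hn⟩
    by_contra hb₀
    exact hc (hI.exists_p_mem_of_mem_component hb hb₀ hn)
  have := (AddSubgroup.closure_le _).2 h₀ (hg a ha)
  rw [AddSubgroup.mem_bot] at this
  rw [this]
  exact TwoSidedIdeal.zero_mem _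

end Grading

end KGraph.KPAlgebra

namespace KGraph.KPAlgebra

variable {k : ℕ} {Λ : KGraph.{u} k} {R : Type w} [CommRing R] {H : Set Λ.Vertex}

/-! ### The representation on functions on the paths avoiding `H` -/

section Representation

open Classical in
variable (R) in
/-- The action of the generators on functions on the infinite paths avoiding `H`. -/
noncomputable def genAction (hH : Λ.IsHereditary H) :
    Λ.KPGen → Module.End R (Λ.AvoidingPath H → R)
  | .vertex a =>
    { toFun := fun f x => if x.vertex = a then f x else 0
      map_add' := fun f g => by ext x; dsimp only [Pi.add_apply]; split_ifs <;> simp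
      map_smul' := fun c f => by ext x; dsimp; split_ifs <;> simp }
  | .path q =>
    { toFun := fun f x => if x.seq (Λ.d q) = q then f (x.shift (Λ.d q)) else 0
      map_add' := fun f g => by ext x; dsimp only [Pi.add_apply]; split_ifs <;> simp
      map_smul' := fun c f => by ext x; dsimp; split_ifs <;> simp }
  | .ghost q =>
    { toFun := fun f x => if h : Λ.s q = x.vertex then f (x.concat hH q h) else 0
      map_add' := fun f g => by ext x; dsimp only [Pi.add_apply]; split_ifs <;> simp
      map_smul' := fun c f => by ext x; dsimp; split_ifs <;> simp }

section Apply

variable (hH : Λ.IsHereditary H) (f : Λ.AvoidingPath H → R) {x : Λ.AvoidingPath H}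

theorem genAction_vertex {a : Λ.Vertex} (h : x.vertex = a) :
    genAction R hH (.vertex a) f x = f x := if_pos h

theorem genAction_vertex_ne {a : Λ.Vertex} (h : x.vertex ≠ a) :
    genAction R hH (.vertex a) f x = 0 := if_neg h

theorem genAction_path {q : Λ.Path} (h : x.seq (Λ.d q) = q) :
    genAction R hH (.path q) f x = f (x.shift (Λ.d q)) := if_pos h

theorem genAction_path_ne {q : Λ.Path} (h : x.seq (Λ.d q) ≠ q) :
    genAction R hH (.path q) f x = 0 := if_neg h

theorem genAction_ghost {q : Λ.Path} (h : Λ.s q = x.vertex) :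
    genAction R hH (.ghost q) f x = f (x.concat hH q h) := dif_pos h

theorem genAction_ghost_ne {q : Λ.Path} (h : Λ.s q ≠ x.vertex) :
    genAction R hH (.ghost q) f x = 0 := dif_neg h

end Apply

variable (R) in
/-- The representation of the free algebra on functions on the infinite paths avoiding `H`. -/
noncomputable def freeAction (hH : Λ.IsHereditary H) :
    Λ.FreeKP R →ₙₐ[R] Module.End R (Λ.AvoidingPath H → R) :=
  MonoidAlgebra.liftMagma R (FreeSemigroup.lift (genAction R hH))

theorem freeAction_freeGen (hH : Λ.IsHereditary H) (g : Λ.KPGen) :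
    freeAction R hH (Λ.freeGen R g) = genAction R hH g := by
  simp [freeAction, freeGen]

theorem concat_concat (hH : Λ.IsHereditary H) {q t : Λ.Path} (h : Λ.s q = Λ.r t)
    {x : Λ.AvoidingPath H} (ht : Λ.s t = x.vertex) :
    (x.concat hH t ht).concat hH q (h.trans (x.vertex_concat hH t ht).symm) =
      x.concat hH (Λ.comp q t h) ((Λ.s_comp _ _ _).trans ht) := by
  refine AvoidingPath.ext_add (Λ.d (Λ.comp q t h)) fun n => ?_
  conv_lhs => rw [Λ.d_comp, add_assoc, AvoidingPath.concat_seq_add]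
  conv_rhs => rw [AvoidingPath.concat_seq_add, Λ.assoc _ _ _ _ (ht.trans (x.r_seq n).symm)]
  exact comp_congr rfl (AvoidingPath.concat_seq_add ..) _

theorem concat_idPath (hH : Λ.IsHereditary H) {x : Λ.AvoidingPath H} {a : Λ.Vertex}
    (h : Λ.s (Λ.idPath a) = x.vertex) : x.concat hH (Λ.idPath a) h = x := by
  have := x.shift_concat hH (Λ.idPath a) h
  rwa [Λ.d_idPath, AvoidingPath.shift_zero] at this

theorem freeAction_eq_of_rel [Λ.RowFinite] (hH : Λ.IsHereditary H) {a b : Λ.FreeKP R}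
    (h : Λ.KPRel R a b) : freeAction R hH a = freeAction R hH b := by
  classical
  cases h <;> simp only [map_mul, map_sum, map_zero, freeAction_freeGen] <;> ext f x <;>
    try simp only [Module.End.mul_apply, LinearMap.zero_apply, LinearMap.sum_apply, Finset.sum_apply,
      Pi.zero_apply]
  case path_id a =>
    by_cases h : x.vertex = a
    · rw [genAction_vertex _ _ h, genAction_path, Λ.d_idPath, x.shift_zero]
      rw [Λ.d_idPath, x.seq_zero, h]
    · rw [genAction_vertex_ne _ _ h, genAction_path_ne]
      rw [Λ.d_idPath, x.seq_zero]
      intro e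
      apply h
      simpa [Λ.r_idPath] using congrArg Λ.r e
  case ghost_id a =>
    by_cases h : x.vertex = a
    · rw [genAction_vertex _ _ h, genAction_ghost _ _ ((Λ.s_idPath a).trans h.symm), concat_idPath]
    · rw [genAction_vertex_ne _ _ h, genAction_ghost_ne]
      rw [Λ.s_idPath]
      exact fun e => h e.symm
  case kp1_self a =>
    by_cases h : x.vertex = a
    · rw [genAction_vertex _ _ h]
    · rw [genAction_vertex_ne _ _ h, genAction_vertex_ne _ _ h]
  case kp1_ne a b hab =>
    by_cases h : x.vertex = a
    · rw [genAction_vertex _ _ h, genAction_vertex_ne]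
      rwa [h]
    · rw [genAction_vertex_ne _ _ h]
  case kp2_path q t h =>
    by_cases hx : x.seq (Λ.d (Λ.comp q t h)) = Λ.comp q t h
    · have hx' := (x.seq_d_comp_iff q t h).1 hx
      rw [genAction_path _ _ hx, genAction_path _ _ hx'.1, genAction_path _ _ hx'.2,
        x.shift_shift, Λ.d_comp]
    · rw [genAction_path_ne _ _ hx]
      by_cases hq : x.seq (Λ.d q) = q
      · rw [genAction_path _ _ hq, genAction_path_ne]
        exact fun ht => hx ((x.seq_d_comp_iff q t h).2 ⟨hq, ht⟩)
      · rw [genAction_path_ne _ _ hq]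
  case kp2_ghost q t h =>
    by_cases hx : Λ.s t = x.vertex
    · rw [genAction_ghost _ _ hx, genAction_ghost _ _ ((Λ.s_comp _ _ _).trans hx),
        genAction_ghost _ _ (h.trans (x.vertex_concat hH t hx).symm), concat_concat]
    · rw [genAction_ghost_ne _ _ hx, genAction_ghost_ne]
      rwa [Λ.s_comp]
  case kp2_range_path q =>
    by_cases hx : x.vertex = Λ.r q
    · rw [genAction_vertex _ _ hx]
    · rw [genAction_vertex_ne _ _ hx, genAction_path_ne]
      intro e
      exact hx (by rw [← e, x.r_seq])
  case kp2_path_source q =>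
    by_cases hx : x.seq (Λ.d q) = q
    · rw [genAction_path _ _ hx, genAction_path _ _ hx, genAction_vertex]
      rw [x.vertex_shift, hx]
    · rw [genAction_path_ne _ _ hx, genAction_path_ne _ _ hx]
  case kp2_source_ghost q =>
    by_cases hx : Λ.s q = x.vertex
    · rw [genAction_vertex _ _ hx.symm]
    · rw [genAction_vertex_ne _ _ (Ne.symm hx), genAction_ghost_ne _ _ hx]
  case kp2_ghost_range q =>
    by_cases hx : Λ.s q = x.vertex
    · rw [genAction_ghost _ _ hx, genAction_ghost _ _ hx, genAction_vertex]
      exact x.vertex_concat hH q hx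
    · rw [genAction_ghost_ne _ _ hx, genAction_ghost_ne _ _ hx]
  case kp3_self q =>
    by_cases hx : Λ.s q = x.vertex
    · rw [genAction_ghost _ _ hx, genAction_vertex _ _ hx.symm,
        genAction_path _ _ (x.concat_seq_d hH q hx), x.shift_concat]
    · rw [genAction_ghost_ne _ _ hx, genAction_vertex_ne _ _ (Ne.symm hx)]
  case kp3_ne q t hd hqt =>
    by_cases hx : Λ.s q = x.vertex
    · rw [genAction_ghost _ _ hx, genAction_path_ne]
      rwa [← hd, x.concat_seq_d]
    · rw [genAction_ghost_ne _ _ hx]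
  case kp4 a n =>
    -- The path `x` has exactly one initial segment of degree `n`; for that `q`, removing and
    -- restoring it returns `x`, and all other terms vanish.
    have key : ∀ q ∈ Λ.pathsFinset a n, genAction R hH (.path q) (genAction R hH (.ghost q) f) x =
        if q = x.seq n then f x else 0 := by
      intro q hq
      obtain ⟨-, rfl⟩ := mem_pathsFinset.1 hq
      split_ifs with h
      · rw [genAction_path _ _ h.symm, genAction_ghost, x.concat_shift hH q h.symm]
        rw [x.vertex_shift, ← h]
      · rw [genAction_path_ne _ _ (Ne.symm h)]
    rw [Finset.sum_congr rfl key, Finset.sum_ite_eq']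
    by_cases h : x.vertex = a
    · rw [genAction_vertex _ _ h, if_pos]
      exact mem_pathsFinset.2 ⟨(x.r_seq n).trans h, x.d_seq n⟩
    · rw [genAction_vertex_ne _ _ h, if_neg]
      exact fun hm => h ((x.r_seq n).symm.trans (mem_pathsFinset.1 hm).1)

theorem freeAction_eq_of_kpCon [Λ.RowFinite] (hH : Λ.IsHereditary H) {a b : Λ.FreeKP R}
    (h : Λ.kpCon R a b) : freeAction R hH a = freeAction R hH b := by
  change RingConGen.Rel (Λ.KPScaledRel R) a b at h
  induction h with
  | of _ _ h =>
    obtain ⟨c, h⟩ := h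
    rw [map_smul, map_smul, freeAction_eq_of_rel hH h]
  | refl _ => rfl
  | symm _ ih => exact ih.symm
  | trans _ _ ih₁ ih₂ => exact ih₁.trans ih₂
  | add _ _ ih₁ ih₂ => rw [map_add, map_add, ih₁, ih₂]
  | mul _ _ ih₁ ih₂ => rw [map_mul, map_mul, ih₁, ih₂]

variable (R) in
/-- The representation of the Kumjian-Pask algebra on functions on the infinite paths
avoiding `H`. -/
noncomputable def action [Λ.RowFinite] (hH : Λ.IsHereditary H) :
    Λ.KPAlgebra R →ₙ+* Module.End R (Λ.AvoidingPath H → R) where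
  toFun := Quotient.lift (freeAction R hH) fun _ _ h => freeAction_eq_of_kpCon hH h
  map_mul' := by rintro ⟨a⟩ ⟨b⟩; exact map_mul (freeAction R hH) a b
  map_zero' := map_zero (freeAction R hH)
  map_add' := by rintro ⟨a⟩ ⟨b⟩; exact map_add (freeAction R hH) a b

theorem action_smul_p [Λ.RowFinite] (hH : Λ.IsHereditary H) (c : R) (a : Λ.Vertex) :
    action R hH (c • p Λ R a) = c • genAction R hH (.vertex a) :=
  (map_smul (freeAction R hH) c _).trans (congrArg _ (freeAction_freeGen hH _))

end Representation

/-! ### The ideal of a hereditary saturated set -/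

section VertexIdeal

variable [Λ.RowFinite]

/-- A path that avoids `H` cannot start in `H`, so `p_a` acts as zero for `a ∈ H`. -/
theorem vertexIdeal_le_ker (hH : Λ.IsHereditary H) :
    vertexIdeal R H ≤ TwoSidedIdeal.ker (action R hH) := by
  refine TwoSidedIdeal.span_le.2 ?_
  rintro _ ⟨a, ha, rfl⟩
  refine (TwoSidedIdeal.mem_ker _).2 ?_
  rw [← one_smul R (p Λ R a), action_smul_p, one_smul]
  ext f x
  refine genAction_vertex_ne hH f ?_
  rintro rfl
  exact x.s_seq 0 (x.s_seq_zero ▸ ha)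

theorem mem_of_smul_p_mem_vertexIdeal (hΛ : Λ.NoSources) (hH : Λ.IsHereditary H)
    (hs : Λ.IsSaturated H) {a : Λ.Vertex} {c : R} (hc : c ≠ 0)
    (h : c • p Λ R a ∈ vertexIdeal R H) : a ∈ H := by
  by_contra ha
  obtain ⟨x, hx⟩ := exists_avoidingPath hΛ hH hs ha
  have h₀ := (TwoSidedIdeal.mem_ker _).1 (vertexIdeal_le_ker hH h)
  rw [action_smul_p] at h₀
  -- On the constant function `1`, evaluated at an avoiding path from `a`, the element `c p_a` gives
  -- the value `c`.
  have h₁ := congrFun (LinearMap.congr_fun h₀ (fun _ => 1)) x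
  rw [LinearMap.smul_apply, Pi.smul_apply, genAction_vertex _ _ hx] at h₁
  exact hc (by simpa using h₁)

theorem p_mem_vertexIdeal_iff [Nontrivial R] (hΛ : Λ.NoSources) (hH : Λ.IsHereditary H)
    (hs : Λ.IsSaturated H) {a : Λ.Vertex} : p Λ R a ∈ vertexIdeal R H ↔ a ∈ H :=
  ⟨fun h => mem_of_smul_p_mem_vertexIdeal hΛ hH hs (one_ne_zero (α := R)) (by rwa [one_smul]),
    p_mem_vertexIdeal⟩

theorem isBasicIdeal_vertexIdeal (hΛ : Λ.NoSources) (hH : Λ.IsHereditary H)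
    (hs : Λ.IsSaturated H) : IsBasicIdeal (vertexIdeal R H) := fun _ _ hc h =>
  p_mem_vertexIdeal (mem_of_smul_p_mem_vertexIdeal hΛ hH hs hc h)

theorem p_ne_zero [Nontrivial R] (hΛ : Λ.NoSources) (a : Λ.Vertex) : p Λ R a ≠ 0 := by
  intro h
  have : p Λ R a ∈ vertexIdeal R (∅ : Set Λ.Vertex) := h ▸ TwoSidedIdeal.zero_mem _
  exact Set.notMem_empty a
    ((p_mem_vertexIdeal_iff hΛ isHereditary_empty (isSaturated_empty hΛ)).1 this)

end VertexIdeal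

end KGraph.KPAlgebra

/-! ### The equivalence -/

open KGraph KGraph.KPAlgebra in
theorem mainTheorem2 {k : ℕ} (hk : 0 < k) (Λ : KGraph.{u} k) [Nonempty Λ.Vertex]
    [Λ.RowFinite] (hΛ : Λ.NoSources) (R : Type w) [CommRing R] [Nontrivial R] :
    List.TFAE [
      Λ.Cofinal,
      IsSimpleGammaMonoid (Multiplicative (Fin k → ℤ)) Λ.TalentedMonoid,
      ∀ H : Set Λ.Vertex, Λ.IsHereditary H ∧ Λ.IsSaturated H ↔ H = ∅ ∨ H = Set.univ,
      KGraph.KPAlgebra.IsGradedBasicIdealSimple Λ R,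
      ∀ I : TwoSidedIdeal (Λ.KPAlgebra R), KGraph.KPAlgebra.IsBasicIdeal I →
        (∃ x : Λ.Vertex, KGraph.KPAlgebra.p Λ R x ∈ I) → I = ⊤] := by
  -- The two trivial sets always qualify, the empty one because there are no sources, so only one
  -- implication of (iii) carries content.
  have h₃ : (∀ H : Set Λ.Vertex, Λ.IsHereditary H ∧ Λ.IsSaturated H ↔ H = ∅ ∨ H = Set.univ) ↔
      ∀ H : Set Λ.Vertex, Λ.IsHereditary H → Λ.IsSaturated H → H = ∅ ∨ H = Set.univ := by
    refine ⟨fun h H hH hs => (h H).1 ⟨hH, hs⟩, fun h H => ⟨fun h' => h H h'.1 h'.2, ?_⟩⟩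
    rintro (rfl | rfl)
    · exact ⟨isHereditary_empty, isSaturated_empty hΛ⟩
    · exact ⟨fun _ _ => trivial, fun _ _ _ => trivial⟩
  rw [h₃]
  tfae_have 1 → 3 := fun h H hH hs => h.eq_empty_or_univ hΛ hH hs
  tfae_have 3 → 1 := cofinal_of_eq_empty_or_univ
  tfae_have 2 ↔ 3 := isSimpleGammaMonoid_iff hΛ
  tfae_have 3 → 5 := by
    rintro h I - ⟨a, ha⟩
    refine eq_top_of_forall_p_mem fun b => ?_
    rcases h _ (isHereditary_p_mem I) (isSaturated_p_mem I) with h | h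
    · exact absurd ha (Set.eq_empty_iff_forall_notMem.1 h a)
    · exact Set.eq_univ_iff_forall.1 h b
  tfae_have 5 → 4 := by
    intro h I hg hI
    exact or_iff_not_imp_left.2 fun h₀ => h I hI (hI.exists_p_mem hg h₀)
  tfae_have 4 → 3 := by
    intro h H hH hs
    rcases h _ (isGradedIdeal_vertexIdeal H) (isBasicIdeal_vertexIdeal hΛ hH hs) with h | h
    · left
      refine Set.eq_empty_iff_forall_notMem.2 fun a ha => p_ne_zero (R := R) hΛ a ?_
      have := p_mem_vertexIdeal (R := R) ha
      rwa [h, TwoSidedIdeal.mem_bot] at this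
    · right
      refine Set.eq_univ_iff_forall.2 fun a => (p_mem_vertexIdeal_iff (R := R) hΛ hH hs).1 ?_
      rw [h]
      trivial
  tfae_finish
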